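/- Let $L$ be a set of $n\ge 2$ lines in the real projective plane in general position (no three of them pass through the same point). Consider the arrangement $\mathcal A(L)$. Its vertices are the crossing points of the lines of $L$. Its edges are the segments into which the vertices cut the lines (a line that carries no vertex has no edge). Its faces are the connected components of the complement of the union of the lines. The size of a face is the number of edges on its boundary. For a vertex $v$ of $\mathcal A(L)$, let $C(v)$ be the size of the face containing $v$ in the arrangement of the lines of $L$ that do not pass through $v$, and let $C(L)$ be the minimum of $C(v)$ over all vertices $v$ of $\mathcal A(L)$. For a line $\ell\in L$, let $C(\ell)$ be the sum of the sizes of all faces of $\mathcal A(L\setminus\{\ell\})$ which contain a segment of $\ell$. Then: 1. every line $\ell\in L$ passes through a vertex $v$ of $\mathcal A(L)$ with $C(v)\le 7$; 2. consequently $C(L)\le 7$; 3. if $n\ge 3$, then for every line $\ell\in L$ $$C(\ell)=\frac12\sum_{v\in\ell}C(v)+2(n-1),$$ where the sum runs over the vertices $v$ of $\mathcal A(L)$ that lie on $\ell$. -/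

import Mathlib

namespace LineArrangement

/-- The real projective plane: nonzero vectors of `ℝ³` up to nonzero scalars. -/
abbrev RP2 : Type := Projectivization ℝ (Fin 3 → ℝ)

/-- The usual topology of the real projective plane, as a quotient of `ℝ³ \ {0}`. -/
noncomputable instance instTopologicalSpaceRP2 : TopologicalSpace RP2 :=
  TopologicalSpace.coinduced (Projectivization.mk' ℝ) inferInstance

/-- Lines of the projective plane, as sets of points: the zero sets of nonzero linear forms. -/
def IsLine (l : Set RP2) : Prop :=
  ∃ a : RP2, l = {p | Projectivization.orthogonal p a}

/-- No three distinct lines of `L` pass through the same point. -/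
def InGeneralPosition (L : Set (Set RP2)) : Prop :=
  ∀ l₁ ∈ L, ∀ l₂ ∈ L, ∀ l₃ ∈ L, l₁ ≠ l₂ → l₁ ≠ l₃ → l₂ ≠ l₃ → l₁ ∩ l₂ ∩ l₃ = ∅

/-- The vertices of the arrangement of `L`: the crossing points of two distinct lines of `L`. -/
def vertices (L : Set (Set RP2)) : Set RP2 :=
  {v | ∃ l₁ ∈ L, ∃ l₂ ∈ L, l₁ ≠ l₂ ∧ v ∈ l₁ ∧ v ∈ l₂}

/-- The edges of the arrangement of `L`: the connected pieces into which the vertices on a line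
of `L` cut that line. A line that carries no vertex (this happens only if it is the only line)
is not cut and has no edge. -/
def edges (L : Set (Set RP2)) : Set (Set RP2) :=
  {e | ∃ l ∈ L, (l ∩ vertices L).Nonempty ∧
    ∃ x ∈ l \ vertices L, e = connectedComponentIn (l \ vertices L) x}

/-- The face of the arrangement of `L` that contains the point `x` (for `x` on no line of `L`):
the connected component of `x` in the complement of the lines. -/
def faceAt (L : Set (Set RP2)) (x : RP2) : Set RP2 :=
  connectedComponentIn (⋃₀ L)ᶜ x

/-- The faces of the arrangement of `L`. -/
def faces (L : Set (Set RP2)) : Set (Set RP2) :=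
  {f | ∃ x ∈ (⋃₀ L)ᶜ, f = faceAt L x}

/-- The size of a face `f` of the arrangement of `L`: the number of edges on its boundary. -/
noncomputable def faceSize (L : Set (Set RP2)) (f : Set RP2) : ℕ :=
  {e ∈ edges L | e ⊆ closure f}.ncard

/-- The zone complexity `C(l)` of a line `l ∈ L`: the sum of the sizes of all the faces of the
arrangement of `L \ {l}` that contain a segment of `l`. (Faces are open, so a face contains a
segment of `l` exactly if it meets `l`.) -/
noncomputable def lineComplexity (L : Set (Set RP2)) (l : Set RP2) : ℕ :=
  ∑ᶠ f ∈ {f ∈ faces (L \ {l}) | (f ∩ l).Nonempty}, faceSize (L \ {l}) f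

/-- The zone complexity `C(v)` of a vertex `v`: the size of the face containing `v` in the
arrangement obtained from `L` by removing the lines through `v` (in general position there are
exactly two of them). -/
noncomputable def vertexComplexity (L : Set (Set RP2)) (v : RP2) : ℕ :=
  faceSize {l ∈ L | v ∉ l} (faceAt {l ∈ L | v ∉ l} v)

/-- `C(L)`: the minimal zone complexity of a vertex of the arrangement of `L`
(meaningful as soon as there is a vertex, that is, if `L` has at least two lines). -/
noncomputable def minVertexComplexity (L : Set (Set RP2)) : ℕ :=
  sInf (vertexComplexity L '' vertices L)

end LineArrangement

/-! Fix `ℓ` and take it as `z = 0`. The other `m = n - 1` lines become `y = t j * x - r j * z` with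
`t` increasing, and line `j` meets `ℓ` at `v_j = (1 : t j : 0)`. For `m ≥ 2` these points cut `ℓ`
into `m` segments lying in `m` distinct cells, and `C(ℓ)` is the sum of the sizes of these cells.

Identity: line `i` separates the two cells adjacent along `ℓ` at `v_i`, and deleting it merges them
into the face that defines `C(v_i)`. Line `i` is a side of both cells. Every side of the merged face
is a side of one of them, and of both exactly when the chord cut out by line `i` ends on it. For `m
≥ 3` the chord ends on two sides, so the two sizes add up to `C(v_i) + 4`
(`GenericPoints.sideCount_add`). Summing over `i` counts every cell twice, whence `2 C(ℓ) = ∑ C(v) +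
4m`.

Bound: by the zone theorem `C(ℓ) ≤ 6m - 4`. Sides whose line crosses `ℓ` before the cell number at
most `3m - 2`, by induction on `m` (`GenericPoints.leftSideCount_le`), and the others are handled by
reflection. If all `C(v)` on `ℓ` were at least 8, the identity would give `C(ℓ) ≥ 6m`.

`IsZeroSets.faceSize_faceAt` turns the topological size of a face into a count of solvable sign
systems, and `exists_coordinates` supplies the coordinates. -/

namespace LineArrangement

/-! ### Cells and their sides as systems of sign conditions. -/

/-- Consider the lines `y = t i * x - r i * z` for `i ∈ s`, in homogeneous coordinates, and the cell
on which the form `y - t j * x + r j * z` has the sign of `σ j` for all `j ∈ s`. The line number `i`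
contributes an edge to that cell. -/
def IsSide (t r : ℕ → ℝ) (s : Finset ℕ) (σ : ℕ → ℝ) (i : ℕ) : Prop :=
  ∃ x z : ℝ, ∀ j ∈ s, j ≠ i → 0 < σ j * ((t i - t j) * x + (r j - r i) * z)

open Classical in
/-- The number of lines contributing an edge to a cell. -/
noncomputable def sideCount (t r : ℕ → ℝ) (s : Finset ℕ) (σ : ℕ → ℝ) : ℕ :=
  (s.filter (IsSide t r s σ)).card

/-- The signs of the `k`-th cell along the line `z = 0`. -/
def cellSign (k j : ℕ) : ℝ := if j < k then 1 else -1

/-- The crossing point of the lines `i` and `j` is a corner of the cell. -/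
def IsCorner (t r : ℕ → ℝ) (s : Finset ℕ) (σ : ℕ → ℝ) (i j : ℕ) : Prop :=
  ∃ x z : ℝ, (t j - t i) * x + (r i - r j) * z = 0 ∧
    ∀ k ∈ s, k ≠ j → 0 < σ k * ((t j - t k) * x + (r k - r j) * z)

lemma IsSide.congr {t r : ℕ → ℝ} {s : Finset ℕ} {σ τ : ℕ → ℝ} (h : ∀ j ∈ s, 0 < σ j * τ j) {i : ℕ}
    (hi : IsSide t r s σ i) : IsSide t r s τ i := by
  obtain ⟨x, z, hx⟩ := hi
  refine ⟨x, z, fun j hj hji => ?_⟩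
  have h1 := mul_pos (h j hj) (hx j hj hji)
  have h2 : σ j ≠ 0 := fun h0 => by simpa [h0] using h j hj
  have h3 : 0 < σ j ^ 2 := by positivity
  refine pos_of_mul_pos_right (a := σ j ^ 2) ?_ h3.le
  nlinarith

lemma sideCount_congr {t r : ℕ → ℝ} {s : Finset ℕ} {σ τ : ℕ → ℝ} (h : ∀ j ∈ s, 0 < σ j * τ j) :
    sideCount t r s σ = sideCount t r s τ := by
  unfold sideCount
  congr 1
  ext i
  simp only [Finset.mem_filter]
  exact and_congr_right fun _ =>
    ⟨IsSide.congr h, IsSide.congr fun j hj => by rw [mul_comm]; exact h j hj⟩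

lemma sideCount_neg (t r : ℕ → ℝ) (s : Finset ℕ) (σ : ℕ → ℝ) :
    sideCount t r s (fun j => -σ j) = sideCount t r s σ := by
  have key : ∀ (σ : ℕ → ℝ) (i : ℕ), IsSide t r s σ i → IsSide t r s (fun j => -σ j) i := by
    rintro σ i ⟨x, z, h⟩
    exact ⟨-x, -z, fun j hj hji => by have := h j hj hji; nlinarith⟩
  unfold sideCount
  congr 1
  ext i
  simp only [Finset.mem_filter]
  exact and_congr_right fun _ => ⟨fun h => by simpa using key _ i h, key _ i⟩

/-- Finitely many strict inequalities survive a small shift. Both directions are kept because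
`IsCorner.isSide` chooses one only afterwards. -/
lemma exists_pos_forall_perturb {s : Finset ℕ} (a b : ℕ → ℝ) (p : ℕ → Prop)
    (h : ∀ j ∈ s, p j → 0 < a j) :
    ∃ δ > 0, ∀ j ∈ s, p j → 0 < a j + b j * δ ∧ 0 < a j - b j * δ := by
  classical
  have h1 : ∀ j ∈ s, ∀ᶠ e in nhds (0 : ℝ), p j → 0 < a j + b j * e ∧ 0 < a j - b j * e := by
    intro j hj
    by_cases hp : p j
    · have c1 : Continuous fun e : ℝ => a j + b j * e := by fun_prop
      have c2 : Continuous fun e : ℝ => a j - b j * e := by fun_prop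
      filter_upwards [c1.continuousAt.eventually_const_lt (by simpa using h j hj hp),
        c2.continuousAt.eventually_const_lt (by simpa using h j hj hp)] with e h1 h2 _
      exact ⟨h1, h2⟩
    · exact Filter.Eventually.of_forall fun e h => absurd h hp
  have h2 := (Filter.eventually_all_finset s).2 h1
  obtain ⟨δ, h3, h4⟩ := ((h2.filter_mono nhdsWithin_le_nhds).and
    (self_mem_nhdsWithin : Set.Ioi (0 : ℝ) ∈ nhdsWithin 0 (Set.Ioi 0))).exists
  exact ⟨δ, h4, h3⟩

/-! ### How a line cuts a cell in two. -/

section Split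

variable {t r : ℕ → ℝ} {s : Finset ℕ} {σ₁ σ₂ : ℕ → ℝ} {i j : ℕ}

lemma IsSide.of_insert (h : IsSide t r (insert i s) σ₁ j) :
    IsSide t r s σ₁ j := by
  obtain ⟨x, z, h⟩ := h
  exact ⟨x, z, fun k hk => h k (Finset.mem_insert_of_mem hk)⟩

/-- Slide the corner slightly along line `j`, in the direction that leads to the prescribed side of
line `i`. -/
lemma IsCorner.isSide (ht : t j ≠ t i) (h1 : σ₁ i ≠ 0)
    (h : IsCorner t r s σ₁ i j) : IsSide t r (insert i s) σ₁ j := by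
  obtain ⟨x, z, h0, h⟩ := h
  obtain ⟨δ, hδ, hp⟩ := exists_pos_forall_perturb
    (fun k => σ₁ k * ((t j - t k) * x + (r k - r j) * z)) (fun k => σ₁ k * (t j - t k)) (· ≠ j) h
  have hne : σ₁ i * (t j - t i) ≠ 0 := mul_ne_zero h1 (sub_ne_zero.2 ht)
  rcases lt_or_gt_of_ne hne with hn | hn
  · refine ⟨x - δ, z, fun k hk hkj => ?_⟩
    rcases Finset.mem_insert.1 hk with rfl | hk
    · have := mul_neg_of_neg_of_pos hn hδ
      linear_combination this - (σ₁ k) * h0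
    · have := (hp k hk hkj).2
      linear_combination this
  · refine ⟨x + δ, z, fun k hk hkj => ?_⟩
    rcases Finset.mem_insert.1 hk with rfl | hk
    · have := mul_pos hn hδ
      linear_combination this - (σ₁ k) * h0
    · have := (hp k hk hkj).1
      linear_combination this

lemma isSide_iff_or (ht : t j ≠ t i) (hσ : ∀ k ∈ s, σ₁ k = σ₂ k)
    (h1 : 0 < σ₁ i) (h2 : σ₂ i < 0) :
    IsSide t r s σ₁ j ↔ IsSide t r (insert i s) σ₁ j ∨ IsSide t r (insert i s) σ₂ j := by
  constructor
  · rintro ⟨x, z, h⟩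
    rcases lt_trichotomy ((t j - t i) * x + (r i - r j) * z) 0 with h0 | h0 | h0
    · refine Or.inr ⟨x, z, fun k hk hkj => ?_⟩
      rcases Finset.mem_insert.1 hk with rfl | hk
      · exact mul_pos_of_neg_of_neg h2 h0
      · rw [← hσ k hk]; exact h k hk hkj
    · exact Or.inl (IsCorner.isSide ht h1.ne' ⟨x, z, h0, h⟩)
    · refine Or.inl ⟨x, z, fun k hk hkj => ?_⟩
      rcases Finset.mem_insert.1 hk with rfl | hk
      · exact mul_pos h1 h0
      · exact h k hk hkj
  · rintro (h | h)
    · exact h.of_insert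
    · obtain ⟨x, z, h⟩ := h.of_insert
      exact ⟨x, z, fun k hk => by rw [hσ k hk]; exact h k hk⟩

lemma isCorner_iff_and (hi : i ∉ s) (hj : j ∈ s) (ht : t j ≠ t i) (hσ : ∀ k ∈ s, σ₁ k = σ₂ k)
    (h1 : 0 < σ₁ i) (h2 : σ₂ i < 0) :
    IsCorner t r s σ₁ i j ↔ IsSide t r (insert i s) σ₁ j ∧ IsSide t r (insert i s) σ₂ j := by
  constructor
  · intro h
    refine ⟨h.isSide ht h1.ne', IsCorner.isSide ht h2.ne ?_⟩
    obtain ⟨x, z, h0, h⟩ := h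
    exact ⟨x, z, h0, fun k hk => by rw [← hσ k hk]; exact h k hk⟩
  · rintro ⟨⟨x, z, h⟩, ⟨x', z', h'⟩⟩
    have hij : i ≠ j := fun h => hi (h ▸ hj)
    have hp := pos_of_mul_pos_right (h i (Finset.mem_insert_self _ _) hij) h1.le
    have hn : (t j - t i) * x' + (r i - r j) * z' < 0 := by
      have := h' i (Finset.mem_insert_self _ _) hij
      by_contra hc
      exact absurd this (not_lt.2 (mul_nonpos_of_nonpos_of_nonneg h2.le (not_lt.1 hc)))
    set v := (t j - t i) * x + (r i - r j) * z with hv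
    set v' := (t j - t i) * x' + (r i - r j) * z' with hv'
    -- The two points of line `j` lie on opposite sides of line `i`; this positive combination of
    -- them lies on line `i`.
    refine ⟨-v' * x + v * x', -v' * z + v * z', by rw [hv, hv']; ring, fun k hk hkj => ?_⟩
    have e1 := mul_pos (neg_pos.2 hn) (h k (Finset.mem_insert_of_mem hk) hkj)
    have e2 := mul_pos hp (h' k (Finset.mem_insert_of_mem hk) hkj)
    rw [← hσ k hk] at e2
    linear_combination e1 + e2

open Classical in
-- Inclusion-exclusion: the sides of the uncut cell are the union of the old sides of both halves,
-- and the corners on line `i` are their intersection. The hypothesis `hσt` places the crossing of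
-- line `i` with `z = 0` inside the uncut cell, so line `i` is a side of both halves.
lemma sideCount_insert_add (hi : i ∉ s) (ht : ∀ k ∈ s, t k ≠ t i) (hσ : ∀ k ∈ s, σ₁ k = σ₂ k)
    (h1 : 0 < σ₁ i) (h2 : σ₂ i < 0) (hσt : ∀ k ∈ s, 0 < σ₁ k * (t i - t k)) :
    sideCount t r (insert i s) σ₁ + sideCount t r (insert i s) σ₂ =
      2 + sideCount t r s σ₁ + (s.filter (IsCorner t r s σ₁ i)).card := by
  have hs1 : IsSide t r (insert i s) σ₁ i := ⟨1, 0, fun k hk hki => by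
    have := hσt k (Finset.mem_of_mem_insert_of_ne hk hki)
    simpa using this⟩
  have hs2 : IsSide t r (insert i s) σ₂ i := ⟨1, 0, fun k hk hki => by
    have hk' := Finset.mem_of_mem_insert_of_ne hk hki
    have := hσt k hk'
    rw [hσ k hk'] at this
    simpa using this⟩
  have hu : s.filter (IsSide t r s σ₁) = s.filter (IsSide t r (insert i s) σ₁) ∪
      s.filter (IsSide t r (insert i s) σ₂) := by
    rw [← Finset.filter_or]
    exact Finset.filter_congr fun k hk => isSide_iff_or (ht k hk) hσ h1 h2
  have hc : s.filter (IsCorner t r s σ₁ i) = s.filter (IsSide t r (insert i s) σ₁) ∩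
      s.filter (IsSide t r (insert i s) σ₂) := by
    rw [← Finset.filter_and]
    exact Finset.filter_congr fun k hk => isCorner_iff_and hi hk (ht k hk) hσ h1 h2
  have hcard := Finset.card_union_add_card_inter (s.filter (IsSide t r (insert i s) σ₁))
    (s.filter (IsSide t r (insert i s) σ₂))
  unfold sideCount
  rw [Finset.filter_insert, Finset.filter_insert, if_pos hs1, if_pos hs2,
    Finset.card_insert_of_notMem (by simp [hi]), Finset.card_insert_of_notMem (by simp [hi]),
    hu, hc]
  omega

/-- In the parameter `-x / z` on line `i`, line `k` crosses at `(r k - r i) / (t i - t k)`, and the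
point `z = 0`, interior to the cell, is at infinity. So a crossing is a corner exactly when all
others lie on one side of it. -/
lemma isCorner_iff (hj : j ∈ s) (ht : ∀ k ∈ s, t k ≠ t i)
    (hσt : ∀ k ∈ s, 0 < σ₁ k * (t i - t k)) :
    IsCorner t r s σ₁ i j ↔ ∃ z : ℝ, ∀ k ∈ s, k ≠ j →
      0 < z * ((r k - r i) / (t i - t k) - (r j - r i) / (t i - t j)) := by
  have hij : t i - t j ≠ 0 := sub_ne_zero.2 (ht j hj).symm
  have key : ∀ k ∈ s, ∀ x z : ℝ, (t j - t i) * x + (r i - r j) * z = 0 →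
      σ₁ k * ((t j - t k) * x + (r k - r j) * z) = (σ₁ k * (t i - t k)) *
        (z * ((r k - r i) / (t i - t k) - (r j - r i) / (t i - t j))) := by
    intro k hk x z h0
    have hik : t i - t k ≠ 0 := sub_ne_zero.2 (ht k hk).symm
    have hx : x = -((r j - r i) / (t i - t j)) * z := by
      field_simp
      linear_combination -h0
    have e1 : (t j - t k) * x + (r k - r j) * z = (t i - t k) * x + (r k - r i) * z := by
      linear_combination h0
    rw [e1, hx]
    field_simp
    ring
  constructor
  · rintro ⟨x, z, h0, h⟩
    refine ⟨z, fun k hk hkj => ?_⟩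
    have := h k hk hkj
    rw [key k hk x z h0] at this
    exact pos_of_mul_pos_right this (hσt k hk).le
  · rintro ⟨z, h⟩
    have h0 : (t j - t i) * (-((r j - r i) / (t i - t j)) * z) + (r i - r j) * z = 0 := by
      field_simp
      ring
    refine ⟨_, z, h0, fun k hk hkj => ?_⟩
    rw [key k hk _ z h0]
    exact mul_pos (hσt k hk) (h k hk hkj)

open Classical in
-- Only the minimum and the maximum qualify; they coincide when `s` is a singleton.
lemma card_filter_extreme (g : ℕ → ℝ) (hg : Set.InjOn g s) :
    (s.filter fun j => ∃ z : ℝ, ∀ k ∈ s, k ≠ j → 0 < z * (g k - g j)).card = min s.card 2 := by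
  rcases s.eq_empty_or_nonempty with rfl | hne
  · simp
  obtain ⟨a, ha, hmin⟩ := s.exists_min_image g hne
  obtain ⟨b, hb, hmax⟩ := s.exists_max_image g hne
  have hset : (s.filter fun j => ∃ z : ℝ, ∀ k ∈ s, k ≠ j → 0 < z * (g k - g j)) = {a, b} := by
    ext j
    simp only [Finset.mem_filter, Finset.mem_insert, Finset.mem_singleton]
    constructor
    · rintro ⟨hj, z, h⟩
      by_contra! hc
      have h1 := h a ha hc.1.symm
      have h2 := h b hb hc.2.symm
      have := hmin j hj
      have := hmax j hj
      rcases le_total 0 z with hz | hz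
      · exact absurd h1 (not_lt.2 (mul_nonpos_of_nonneg_of_nonpos hz (by linarith)))
      · exact absurd h2 (not_lt.2 (mul_nonpos_of_nonpos_of_nonneg hz (by linarith)))
    · rintro (rfl | rfl)
      · refine ⟨ha, 1, fun k hk hkj => ?_⟩
        have := lt_of_le_of_ne (hmin k hk) (fun h => hkj (hg ha hk h).symm)
        linarith
      · refine ⟨hb, -1, fun k hk hkj => ?_⟩
        have := lt_of_le_of_ne (hmax k hk) (fun h => hkj (hg hk hb h))
        linarith
  rw [hset]
  by_cases hab : a = b
  · subst hab
    have : s = {a} := by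
      refine Finset.eq_singleton_iff_unique_mem.2 ⟨ha, fun k hk => ?_⟩
      exact hg hk ha (le_antisymm (hmax k hk) (hmin k hk))
    rw [this]; simp
  · rw [Finset.card_pair hab]
    have : 2 ≤ s.card := by
      rw [← Finset.card_pair hab]
      exact Finset.card_le_card (by intro k; simp; rintro (rfl | rfl) <;> assumption)
    omega

end Split

/-! ### The two cells at a vertex, and the zone bound. -/

/-- No three of the points `(t i, r i)`, `i < m`, are collinear, and their abscissas increase. -/
structure GenericPoints (t r : ℕ → ℝ) (m : ℕ) : Prop where
  lt : ∀ i j, i < j → j < m → t i < t j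
  ncol : ∀ i j k, i < m → j < m → k < m → i ≠ j → i ≠ k → j ≠ k →
    (t j - t i) * (r k - r i) ≠ (t k - t i) * (r j - r i)

variable {t r : ℕ → ℝ} {m : ℕ}

lemma GenericPoints.mono (h : GenericPoints t r m) {m' : ℕ} (hm : m' ≤ m) :
    GenericPoints t r m' :=
  ⟨fun i j hij hj => h.lt i j hij (hj.trans_le hm), fun i j k hi hj hk =>
    h.ncol i j k (hi.trans_le hm) (hj.trans_le hm) (hk.trans_le hm)⟩

lemma GenericPoints.cellSign_mul_pos (h : GenericPoints t r m) {i k : ℕ} (hi : i < m) (hk : k < m)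
    (hki : k ≠ i) : 0 < cellSign (i + 1) k * (t i - t k) := by
  unfold cellSign
  rcases lt_or_gt_of_ne hki with h1 | h1
  · have := h.lt k i h1 hi
    rw [if_pos (by omega)]; linarith
  · have := h.lt i k h1 hk
    rw [if_neg (by omega)]; linarith

/-- The sign vectors of cells `i` and `i + 1` differ only at line `i`, so these cells are the two
halves of the face left when line `i` is erased. Noncollinearity makes the crossings on line `i`
distinct. -/
lemma GenericPoints.sideCount_add (h : GenericPoints t r m) {i : ℕ} (hi : i < m) :
    sideCount t r (Finset.range m) (cellSign (i + 1)) + sideCount t r (Finset.range m) (cellSign i) =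
      2 + sideCount t r ((Finset.range m).erase i) (cellSign (i + 1)) + min (m - 1) 2 := by
  classical
  have hne : ∀ k ∈ (Finset.range m).erase i, t k ≠ t i := by
    intro k hk
    rw [Finset.mem_erase, Finset.mem_range] at hk
    rcases lt_or_gt_of_ne hk.1 with h1 | h1
    · exact (h.lt k i h1 hi).ne
    · exact (h.lt i k h1 hk.2).ne'
  have hsign : ∀ k ∈ (Finset.range m).erase i, 0 < cellSign (i + 1) k * (t i - t k) := by
    intro k hk
    rw [Finset.mem_erase, Finset.mem_range] at hk
    exact h.cellSign_mul_pos hi hk.2 hk.1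
  have hins : insert i ((Finset.range m).erase i) = Finset.range m :=
    Finset.insert_erase (Finset.mem_range.2 hi)
  have := sideCount_insert_add (r := r) (σ₁ := cellSign (i + 1)) (σ₂ := cellSign i)
    (Finset.notMem_erase i (Finset.range m)) hne
    (fun k hk => by
      have := (Finset.mem_erase.1 hk).1
      unfold cellSign
      congr 1
      simp only [eq_iff_iff]; omega)
    (by simp [cellSign]) (by simp [cellSign]) hsign
  rw [hins] at this
  rw [this, Finset.filter_congr fun j hj =>
    isCorner_iff hj hne hsign,
    card_filter_extreme fun j => (r j - r i) / (t i - t j)]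
  · rw [Finset.card_erase_of_mem (Finset.mem_range.2 hi), Finset.card_range]
  · intro j hj k hk hjk
    by_contra hjk'
    have hj' := hne j hj
    have hk' := hne k hk
    simp only [Finset.coe_erase, Finset.coe_range, Set.mem_sdiff, Set.mem_Iio,
      Set.mem_singleton_iff] at hj hk
    refine h.ncol i j k hi hj.1 hk.1 (Ne.symm hj.2) (Ne.symm hk.2) hjk' ?_
    rw [div_eq_div_iff (sub_ne_zero.2 hj'.symm) (sub_ne_zero.2 hk'.symm)] at hjk
    linear_combination hjk

open Classical in
/-- The number of pairs of a cell along the line `z = 0` and a side of it that belongs to a line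
crossing `z = 0` before that cell. -/
noncomputable def leftSideCount (t r : ℕ → ℝ) (m : ℕ) : ℕ :=
  ∑ k ∈ Finset.range (m + 1),
    ((Finset.range m).filter fun j => j < k ∧ IsSide t r (Finset.range m) (cellSign k) j).card

/-- Add the line with the last crossing. Earlier cells gain no left side. The old last cell, all of
whose sides are left sides, splits in two with at most 4 more sides in total; in the first half the
new line is a side but not a left one, so the count grows by at most 3. -/
lemma GenericPoints.leftSideCount_le (h : GenericPoints t r m) (hm : 1 ≤ m) :
    leftSideCount t r m ≤ 3 * m - 2 := by
  classical
  induction m, hm using Nat.le_induction with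
  | base =>
    simp only [leftSideCount, Finset.sum_range_succ, Finset.range_zero, Finset.sum_empty]
    have h1 : ((Finset.range 1).filter fun j => j < 0 ∧
        IsSide t r (Finset.range 1) (cellSign 0) j).card = 0 := by simp
    have h2 := Finset.card_filter_le (Finset.range 1)
      fun j => j < 1 ∧ IsSide t r (Finset.range 1) (cellSign 1) j
    simp only [Finset.card_range] at h2
    omega
  | succ m hm ih =>
    have ih := ih (h.mono m.le_succ)
    have hadd := h.sideCount_add (Nat.lt_succ_self m)
    have her : (Finset.range (m + 1)).erase m = Finset.range m := by
      ext; simp; omega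
    rw [her] at hadd
    have hle : ∀ k ∈ Finset.range m, ((Finset.range (m + 1)).filter fun j => j < k ∧
        IsSide t r (Finset.range (m + 1)) (cellSign k) j).card ≤
        ((Finset.range m).filter fun j => j < k ∧
        IsSide t r (Finset.range m) (cellSign k) j).card := by
      intro k hk
      refine Finset.card_le_card fun j hj => ?_
      simp only [Finset.mem_filter, Finset.mem_range] at hj hk ⊢
      refine ⟨by omega, hj.2.1, ?_⟩
      have := hj.2.2
      rw [Finset.range_add_one] at this
      exact this.of_insert
    have e1 : ((Finset.range m).filter fun j => j < m ∧
        IsSide t r (Finset.range m) (cellSign m) j).card =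
        sideCount t r (Finset.range m) (cellSign (m + 1)) := by
      rw [sideCount_congr (τ := cellSign m)]
      · unfold sideCount
        congr 1
        refine Finset.filter_congr fun j hj => ?_
        simp only [Finset.mem_range] at hj
        simp [hj]
      · intro j hj
        simp only [Finset.mem_range] at hj
        simp [cellSign, hj, hj.trans (Nat.lt_succ_self m)]
    have e2 : ((Finset.range (m + 1)).filter fun j => j < m + 1 ∧
        IsSide t r (Finset.range (m + 1)) (cellSign (m + 1)) j).card =
        sideCount t r (Finset.range (m + 1)) (cellSign (m + 1)) := by
      unfold sideCount
      congr 1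
      refine Finset.filter_congr fun j hj => ?_
      simp only [Finset.mem_range] at hj
      simp [hj]
    have e3 : ((Finset.range (m + 1)).filter fun j => j < m ∧
        IsSide t r (Finset.range (m + 1)) (cellSign m) j).card + 1 ≤
        sideCount t r (Finset.range (m + 1)) (cellSign m) := by
      unfold sideCount
      rw [← Finset.card_insert_of_notMem (a := m) (by simp)]
      refine Finset.card_le_card fun j hj => ?_
      simp only [Finset.mem_filter, Finset.mem_range, Finset.mem_insert] at hj ⊢
      rcases hj with rfl | hj
      · refine ⟨Nat.lt_succ_self j, 1, 0, fun k hk hkj => ?_⟩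
        rw [Finset.mem_range] at hk
        have hk' : k < j := by omega
        have := h.lt k j hk' (Nat.lt_succ_self j)
        simp [cellSign, hk', this]
      · exact ⟨hj.1, hj.2.2⟩
    have hsum := Finset.sum_le_sum hle
    unfold leftSideCount at ih ⊢
    rw [Finset.sum_range_succ] at ih
    rw [Finset.sum_range_succ, Finset.sum_range_succ, e2]
    rw [e1] at ih
    have := min_le_right (m + 1 - 1) 2
    omega

/-- Reversing the order of the lines along the line `z = 0`. -/
lemma GenericPoints.reverse (h : GenericPoints t r m) :
    GenericPoints (fun j => -t (m - 1 - j)) (fun j => r (m - 1 - j)) m := by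
  refine ⟨fun i j hij hj => ?_, fun i j k hi hj hk hij hik hjk he => ?_⟩
  · have := h.lt (m - 1 - j) (m - 1 - i) (by omega) (by omega)
    simpa using this
  · refine h.ncol (m - 1 - i) (m - 1 - j) (m - 1 - k) (by omega) (by omega) (by omega) (by omega)
      (by omega) (by omega) ?_
    linear_combination -he

/-- The reflection `(x, y, z) ↦ (x, -y, -z)` carries each form to the negative of the reindexed one,
and reversing the order also negates the cell signs. -/
lemma isSide_reverse {k j : ℕ} (hk : k ≤ m) (hj : j < m)
    (h : IsSide t r (Finset.range m) (cellSign k) j) :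
    IsSide (fun j => -t (m - 1 - j)) (fun j => r (m - 1 - j)) (Finset.range m)
      (cellSign (m - k)) (m - 1 - j) := by
  obtain ⟨x, z, h⟩ := h
  refine ⟨x, -z, fun i hi hij => ?_⟩
  rw [Finset.mem_range] at hi
  have := h (m - 1 - i) (Finset.mem_range.2 (by omega)) (by omega)
  have e : m - 1 - (m - 1 - j) = j := by omega
  have hs : cellSign (m - k) i = -cellSign k (m - 1 - i) := by
    unfold cellSign
    split_ifs <;> first | omega | norm_num
  simp only [e, hs]
  linear_combination this

/-- A side that is not a left side becomes one after reversal. The terms `k = 0` and `k = m` belong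
to the same projective cell, so the bound even allows for counting it twice. -/
lemma GenericPoints.sum_sideCount_le (h : GenericPoints t r m) (hm : 1 ≤ m) :
    ∑ k ∈ Finset.range (m + 1), sideCount t r (Finset.range m) (cellSign k) ≤ 6 * m - 4 := by
  classical
  have h1 := h.leftSideCount_le hm
  have h2 := h.reverse.leftSideCount_le hm
  have key : ∑ k ∈ Finset.range (m + 1), sideCount t r (Finset.range m) (cellSign k) ≤
      leftSideCount t r m + leftSideCount (fun j => -t (m - 1 - j)) (fun j => r (m - 1 - j)) m := by
    unfold leftSideCount
    rw [← Finset.sum_range_reflect (n := m + 1) (fun k => ((Finset.range m).filter fun j => j < k ∧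
      IsSide (fun j => -t (m - 1 - j)) (fun j => r (m - 1 - j)) (Finset.range m)
        (cellSign k) j).card), ← Finset.sum_add_distrib]
    refine Finset.sum_le_sum fun k hk => ?_
    rw [Finset.mem_range] at hk
    unfold sideCount
    rw [← Finset.card_filter_add_card_filter_not (s := (Finset.range m).filter
      (IsSide t r (Finset.range m) (cellSign k))) (fun j => j < k)]
    refine add_le_add (Finset.card_le_card fun j hj => ?_) ?_
    · simp only [Finset.mem_filter] at hj ⊢
      exact ⟨hj.1.1, hj.2, hj.1.2⟩
    · refine Finset.card_le_card_of_injOn (fun j => m - 1 - j) (fun j hj => ?_) ?_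
      · simp only [Finset.coe_filter, Finset.mem_filter, Finset.mem_range, Set.mem_ofPred_eq] at hj ⊢
        have := isSide_reverse (by omega) hj.1.1 hj.1.2
        rw [show m + 1 - 1 - k = m - k by omega]
        exact ⟨by omega, by omega, this⟩
      · intro i hi j hj hij
        simp only [Finset.coe_filter, Finset.mem_filter, Finset.mem_range, Set.mem_ofPred_eq] at hi hj
        simp only at hij
        omega
  omega

/-- The segment after the last crossing continues through infinity to the one before the first: the
sign vectors are opposite. -/
lemma sideCount_cellSign_zero (t r : ℕ → ℝ) (m : ℕ) :
    sideCount t r (Finset.range m) (cellSign 0) = sideCount t r (Finset.range m) (cellSign m) := by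
  rw [← sideCount_neg]
  refine sideCount_congr fun j hj => ?_
  rw [Finset.mem_range] at hj
  simp [cellSign, hj]

/-! ### Signs of linear forms and the topology of the projective plane. -/

open Projectivization

lemma continuous_mk' : Continuous (Projectivization.mk' ℝ : {v : Fin 3 → ℝ // v ≠ 0} → RP2) :=
  continuous_coinduced_rng

lemma isPreconnected_mk_image {S : Set (Fin 3 → ℝ)} (hS : IsPreconnected S)
    (h0 : ∀ x ∈ S, x ≠ 0) : IsPreconnected {p : RP2 | ∃ x hx, x ∈ S ∧ mk ℝ x hx = p} := by
  have hc : Continuous fun x : S => (Projectivization.mk' ℝ ⟨x.1, h0 x.1 x.2⟩ : RP2) :=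
    continuous_mk'.comp (by fun_prop)
  have := (isPreconnected_iff_preconnectedSpace.1 hS).isPreconnected_univ.image _ hc.continuousOn
  convert this using 1
  ext p
  constructor
  · rintro ⟨x, hx, hxS, rfl⟩
    exact ⟨⟨x, hxS⟩, trivial, rfl⟩
  · rintro ⟨⟨x, hxS⟩, -, rfl⟩
    exact ⟨x, h0 x hxS, hxS, rfl⟩

lemma mk_mem_closure {U : Set (Fin 3 → ℝ)} {F : Set RP2} {z : Fin 3 → ℝ} (hz : z ≠ 0)
    (hzU : z ∈ closure U) (hU : ∀ x ∈ U, ∃ hx, mk ℝ x hx ∈ F) : mk ℝ z hz ∈ closure F := by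
  refine map_mem_closure (s := {x : {v : Fin 3 → ℝ // v ≠ 0} | x.1 ∈ U}) (x := ⟨z, hz⟩)
    continuous_mk' ?_ ?_
  · rw [closure_subtype]
    convert hzU
    ext x
    constructor
    · rintro ⟨x, hx, rfl⟩
      exact hx
    · intro hx
      exact ⟨⟨x, (hU x hx).1⟩, hx, rfl⟩
  · rintro ⟨x, hx⟩ hxU
    exact (hU x hxU).2

lemma mk_neg {x : Fin 3 → ℝ} (hx : x ≠ 0) : mk ℝ (-x) (neg_ne_zero.2 hx) = mk ℝ x hx :=
  (mk_eq_mk_iff' ℝ _ _ _ _).2 ⟨-1, by simp⟩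

/-- The points at which two linear forms have the same sign. -/
def posSet (φ ψ : (Fin 3 → ℝ) →ₗ[ℝ] ℝ) : Set RP2 := {p | 0 < φ p.rep * ψ p.rep}

lemma mk_mem_posSet {φ ψ : (Fin 3 → ℝ) →ₗ[ℝ] ℝ} {x : Fin 3 → ℝ} (hx : x ≠ 0) :
    mk ℝ x hx ∈ posSet φ ψ ↔ 0 < φ x * ψ x := by
  obtain ⟨a, ha⟩ := exists_smul_eq_mk_rep ℝ x hx
  have h2 : 0 < (a : ℝ) ^ 2 := by have := a.ne_zero; positivity
  have e : φ (mk ℝ x hx).rep * ψ (mk ℝ x hx).rep = (a : ℝ) ^ 2 * (φ x * ψ x) := by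
    rw [← ha, Units.smul_def, map_smul, map_smul, smul_eq_mul, smul_eq_mul]
    ring
  change 0 < φ (mk ℝ x hx).rep * ψ (mk ℝ x hx).rep ↔ _
  rw [e, mul_pos_iff_of_pos_left h2]

lemma isOpen_posSet (φ ψ : (Fin 3 → ℝ) →ₗ[ℝ] ℝ) : IsOpen (posSet φ ψ) := by
  refine isOpen_coinduced.2 ?_
  have : Projectivization.mk' ℝ ⁻¹' posSet φ ψ =
      {x : {v : Fin 3 → ℝ // v ≠ 0} | 0 < φ x.1 * ψ x.1} := by
    ext x
    exact mk_mem_posSet x.2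
  rw [this]
  have h1 := φ.continuous_of_finiteDimensional
  have h2 := ψ.continuous_of_finiteDimensional
  exact isOpen_lt (by fun_prop) (by fun_prop)

/-- One form has no sign at a projective point, but a product of two does. The sets where it is
positive and negative are open, so it cannot change sign on a preconnected set that avoids its
zeros. -/
lemma IsPreconnected.sign_mul_pos {φ ψ : (Fin 3 → ℝ) →ₗ[ℝ] ℝ} {S : Set RP2}
    (hS : IsPreconnected S) (h : ∀ x hx, mk ℝ x hx ∈ S → φ x ≠ 0 ∧ ψ x ≠ 0) {x y : Fin 3 → ℝ}
    (hx : x ≠ 0) (hy : y ≠ 0) (hxS : mk ℝ x hx ∈ S) (hyS : mk ℝ y hy ∈ S) :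
    0 < (φ y * φ x) * (ψ y * ψ x) := by
  set c := φ y * ψ y with hc
  have hc0 : c ≠ 0 := mul_ne_zero (h y hy hyS).1 (h y hy hyS).2
  have hsub := hS.subset_left_of_subset_union (isOpen_posSet φ (c • ψ))
    (isOpen_posSet φ ((-c) • ψ)) ?_ ?_ ?_
  · have := (mk_mem_posSet hx).1 (hsub hxS)
    simp only [LinearMap.smul_apply, smul_eq_mul, hc] at this
    linear_combination this
  · rw [Set.disjoint_left]
    intro p
    induction p using Projectivization.ind with | h v hv =>
    rw [mk_mem_posSet, mk_mem_posSet]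
    simp only [LinearMap.smul_apply, smul_eq_mul]
    intro h1 h2
    linarith
  · intro p
    induction p using Projectivization.ind with | h v hv =>
    intro hp
    rw [Set.mem_union, mk_mem_posSet, mk_mem_posSet]
    simp only [LinearMap.smul_apply, smul_eq_mul]
    have h0 : φ v * (c * ψ v) ≠ 0 := mul_ne_zero (h v hv hp).1 (mul_ne_zero hc0 (h v hv hp).2)
    rcases lt_or_gt_of_ne h0 with h1 | h1
    · right; linarith
    · left; exact h1
  · refine ⟨_, hyS, (mk_mem_posSet hy).2 ?_⟩
    have : 0 < c ^ 2 := by positivity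
    simp only [LinearMap.smul_apply, smul_eq_mul]
    calc 0 < c ^ 2 := this
      _ = _ := by rw [hc]; ring

/-! ### Faces and edges described by signs. -/

section Arrangement

variable {ι : Type*} {s : Finset ι} {e : ι → Set RP2} {φ : ι → (Fin 3 → ℝ) →ₗ[ℝ] ℝ}

/-- The sets `e i`, for `i ∈ s`, are the zero sets of the linear forms `φ i`. -/
def IsZeroSets (s : Finset ι) (e : ι → Set RP2) (φ : ι → (Fin 3 → ℝ) →ₗ[ℝ] ℝ) : Prop :=
  ∀ i ∈ s, ∀ x hx, mk ℝ x hx ∈ e i ↔ φ i x = 0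

lemma IsZeroSets.mono (h : IsZeroSets s e φ) {s' : Finset ι} (hs : s' ⊆ s) : IsZeroSets s' e φ :=
  fun i hi => h i (hs hi)

lemma IsZeroSets.mk_mem_compl (h : IsZeroSets s e φ) {x : Fin 3 → ℝ} (hx : x ≠ 0) :
    mk ℝ x hx ∈ (⋃₀ (e '' s))ᶜ ↔ ∀ i ∈ s, φ i x ≠ 0 := by
  simp only [Set.mem_compl_iff, Set.mem_sUnion, Set.mem_image, Finset.mem_coe,
    exists_exists_and_eq_and, not_exists, not_and]
  exact forall₂_congr fun i hi => not_congr (h i hi x hx)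

lemma ne_zero_of_mem_segment {φ : (Fin 3 → ℝ) →ₗ[ℝ] ℝ} {x y w : Fin 3 → ℝ} {c : ℝ}
    (hx : 0 < c * φ x) (hy : 0 < c * φ y) (hw : w ∈ segment ℝ x y) : 0 < c * φ w := by
  obtain ⟨a, b, ha, hb, hab, rfl⟩ := hw
  rw [map_add, map_smul, map_smul, smul_eq_mul, smul_eq_mul]
  rcases ha.eq_or_lt with rfl | ha
  · have : b = 1 := by linarith
    subst this; simpa using hy
  · have e1 := mul_pos ha hx
    have e2 := mul_nonneg hb hy.le
    linarith

/-- All forms are compared with a fixed one, `φ i₀`; the two alternatives reflect the choice between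
`x` and `-x`. Conversely, the segment between suitable representatives meets no line. -/
lemma IsZeroSets.mk_mem_faceAt_iff (h : IsZeroSets s e φ) (hs : s.Nonempty) {x y : Fin 3 → ℝ}
    (hx : x ≠ 0) (hy : y ≠ 0) (hys : ∀ i ∈ s, φ i y ≠ 0) :
    mk ℝ x hx ∈ faceAt (e '' s) (mk ℝ y hy) ↔
      (∀ i ∈ s, 0 < φ i y * φ i x) ∨ (∀ i ∈ s, φ i y * φ i x < 0) := by
  obtain ⟨i₀, hi₀⟩ := hs
  have hmem := (h.mk_mem_compl hy).2 hys
  constructor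
  · intro hxf
    have key : ∀ j ∈ s, 0 < (φ i₀ y * φ i₀ x) * (φ j y * φ j x) := by
      intro j hj
      refine IsPreconnected.sign_mul_pos isPreconnected_connectedComponentIn ?_ hx hy hxf
        (mem_connectedComponentIn hmem)
      intro z hz hzf
      have := (h.mk_mem_compl hz).1 (connectedComponentIn_subset _ _ hzf)
      exact ⟨this _ hi₀, this _ hj⟩
    rcases lt_trichotomy (φ i₀ y * φ i₀ x) 0 with h0 | h0 | h0
    · exact Or.inr fun j hj => by
        by_contra hc
        exact absurd (key j hj) (not_lt.2 (mul_nonpos_of_nonpos_of_nonneg h0.le (not_lt.1 hc)))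
    · exact absurd (key i₀ hi₀) (by simp [h0])
    · exact Or.inl fun j hj => pos_of_mul_pos_right (key j hj) h0.le
  · have main : ∀ x hx, (∀ i ∈ s, 0 < φ i y * φ i x) →
        mk ℝ x hx ∈ faceAt (e '' s) (mk ℝ y hy) := by
      intro x hx hpos
      have hseg : ∀ w ∈ segment ℝ y x, ∀ i ∈ s, φ i w ≠ 0 := fun w hw i hi h0 => by
        have := ne_zero_of_mem_segment (mul_self_pos.2 (hys i hi)) (hpos i hi) hw
        simp [h0] at this
      have hseg0 : ∀ w ∈ segment ℝ y x, w ≠ 0 := fun w hw h0 =>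
        hseg w hw i₀ hi₀ (by simp [h0])
      refine (isPreconnected_mk_image (convex_segment y x).isPreconnected hseg0
        ).subset_connectedComponentIn ?_ ?_ ?_
      · exact ⟨y, hy, left_mem_segment ℝ y x, rfl⟩
      · rintro _ ⟨w, hw0, hw, rfl⟩
        exact (h.mk_mem_compl hw0).2 (hseg w hw)
      · exact ⟨x, hx, right_mem_segment ℝ y x, rfl⟩
    rintro (h1 | h1)
    · exact main x hx h1
    · rw [← mk_neg hx]
      exact main _ _ fun i hi => by have := h1 i hi; simpa using this

lemma faceAt_eq_iff {L : Set (Set RP2)} {p q : RP2} (hp : p ∈ (⋃₀ L)ᶜ) :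
    faceAt L p = faceAt L q ↔ p ∈ faceAt L q :=
  ⟨fun h => h ▸ mem_connectedComponentIn hp, fun h => (connectedComponentIn_eq h).symm⟩

lemma mem_vertices_image (he : Set.InjOn e s) {i : ι} (hi : i ∈ s) {p : RP2} (hp : p ∈ e i) :
    p ∈ vertices (e '' s) ↔ ∃ j ∈ s, j ≠ i ∧ p ∈ e j := by
  constructor
  · rintro ⟨_, ⟨j, hj, rfl⟩, _, ⟨k, hk, rfl⟩, hjk, hpj, hpk⟩
    by_cases hji : j = i
    · exact ⟨k, hk, fun hki => hjk (by rw [hji, hki]), hpk⟩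
    · exact ⟨j, hj, hji, hpj⟩
  · rintro ⟨j, hj, hji, hpj⟩
    exact ⟨_, ⟨i, hi, rfl⟩, _, ⟨j, hj, rfl⟩, fun hij => hji (he hi hj hij).symm, hp, hpj⟩

lemma IsZeroSets.mk_mem_sdiff (h : IsZeroSets s e φ) (he : Set.InjOn e s) {i : ι} (hi : i ∈ s)
    {x : Fin 3 → ℝ} (hx : x ≠ 0) : mk ℝ x hx ∈ e i \ vertices (e '' s) ↔
      φ i x = 0 ∧ ∀ j ∈ s, j ≠ i → φ j x ≠ 0 := by
  rw [Set.mem_sdiff, ← h i hi x hx]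
  refine and_congr_right fun hxi => ?_
  rw [mem_vertices_image he hi hxi]
  simp only [not_exists, not_and]
  exact forall₃_congr fun j hj _ => not_congr (h j hj x hx)

lemma exists_common_zero (φ ψ : (Fin 3 → ℝ) →ₗ[ℝ] ℝ) : ∃ x ≠ 0, φ x = 0 ∧ ψ x = 0 := by
  have : LinearMap.ker (φ.prod ψ) ≠ ⊥ := LinearMap.ker_ne_bot_of_finrank_lt (by simp)
  obtain ⟨x, hx, hx0⟩ := Submodule.exists_mem_ne_zero_of_ne_bot this
  rw [LinearMap.mem_ker] at hx
  exact ⟨x, hx0, congrArg Prod.fst hx, congrArg Prod.snd hx⟩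

/-- The line `i` contributes an edge to the face that contains the point with homogeneous
coordinates `y`. -/
def IsSideAt (s : Finset ι) (φ : ι → (Fin 3 → ℝ) →ₗ[ℝ] ℝ) (y : Fin 3 → ℝ) (i : ι) : Prop :=
  ∃ x, φ i x = 0 ∧ ∀ j ∈ s, j ≠ i → 0 < φ j y * φ j x

/-- Along the edge of `x` the relative signs are constant, so each of its points has a
representative `z` with the signs of `y`. Then `z + ε • y` lies in the face for every `ε > 0` and
tends to `z`. -/
lemma IsZeroSets.subset_closure_faceAt (h : IsZeroSets s e φ) (he : Set.InjOn e s) (hs : 2 ≤ s.card)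
    {y : Fin 3 → ℝ} (hy : y ≠ 0) (hys : ∀ i ∈ s, φ i y ≠ 0) {i : ι} (hi : i ∈ s)
    {x : Fin 3 → ℝ} (hx0 : x ≠ 0) (hx : φ i x = 0) (hxs : ∀ j ∈ s, j ≠ i → 0 < φ j y * φ j x) :
    connectedComponentIn (e i \ vertices (e '' s)) (mk ℝ x hx0) ⊆
      closure (faceAt (e '' s) (mk ℝ y hy)) := by
  obtain ⟨j₀, hj₀, hji₀⟩ := Finset.exists_mem_ne (s := s) (by omega) i
  have hxm : mk ℝ x hx0 ∈ e i \ vertices (e '' s) :=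
    (h.mk_mem_sdiff he hi hx0).2 ⟨hx, fun j hj hji h0 => by
      have := hxs j hj hji; simp [h0] at this⟩
  have main : ∀ z hz, φ i z = 0 → (∀ j ∈ s, j ≠ i → 0 < φ j y * φ j z) →
      mk ℝ z hz ∈ closure (faceAt (e '' s) (mk ℝ y hy)) := by
    intro z hz hiz hzs
    have hpos : ∀ ε : ℝ, 0 < ε → ∀ j ∈ s, 0 < φ j y * φ j (z + ε • y) := by
      intro ε hε j hj
      have h1 : 0 < ε * (φ j y * φ j y) := mul_pos hε (mul_self_pos.2 (hys j hj))
      rw [map_add, map_smul, smul_eq_mul]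
      by_cases hji : j = i
      · subst hji; rw [hiz]; linarith
      · have := hzs j hj hji; linarith
    refine mk_mem_closure (U := (fun ε : ℝ => z + ε • y) '' Set.Ioi 0) hz ?_ ?_
    · have hc : ContinuousWithinAt (fun ε : ℝ => z + ε • y) (Set.Ioi 0) 0 :=
        (by fun_prop : Continuous fun ε : ℝ => z + ε • y).continuousWithinAt
      have := hc.mem_closure_image (by rw [closure_Ioi]; exact Set.self_mem_Ici)
      simpa using this
    · rintro _ ⟨ε, hε, rfl⟩
      have hne : z + ε • y ≠ 0 := fun h0 => by
        have := hpos ε hε i hi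
        replace h0 : z + ε • y = 0 := h0
        rw [h0] at this
        simp at this
      exact ⟨hne, (h.mk_mem_faceAt_iff ⟨i, hi⟩ hne hy hys).2 (Or.inl (hpos ε hε))⟩
  intro p
  induction p using Projectivization.ind with | h z hz =>
  intro hzc
  have hzm := (h.mk_mem_sdiff he hi hz).1 (connectedComponentIn_subset _ _ hzc)
  have key : ∀ j ∈ s, j ≠ i → 0 < (φ j₀ x * φ j₀ z) * (φ j x * φ j z) := by
    intro j hj hji
    refine IsPreconnected.sign_mul_pos isPreconnected_connectedComponentIn ?_ hz hx0 hzc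
      (mem_connectedComponentIn hxm)
    intro w hw hwc
    have := (h.mk_mem_sdiff he hi hw).1 (connectedComponentIn_subset _ _ hwc)
    exact ⟨this.2 _ hj₀ hji₀, this.2 _ hj hji⟩
  have hsq : ∀ j ∈ s, j ≠ i → 0 < φ j x ^ 2 := by
    intro j hj hji
    have h1 : φ j x ≠ 0 := fun h0 => by have := hxs j hj hji; simp [h0] at this
    positivity
  rcases lt_trichotomy (φ j₀ x * φ j₀ z) 0 with h0 | h0 | h0
  · rw [← mk_neg hz]
    refine main _ _ (by simp [hzm.1]) fun j hj hji => ?_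
    have h1 : 0 < -(φ j x * φ j z) := by
      have := key j hj hji
      by_contra hc
      exact absurd this (not_lt.2 (mul_nonpos_of_nonpos_of_nonneg h0.le (by linarith)))
    have h2 := mul_pos h1 (hxs j hj hji)
    refine pos_of_mul_pos_right (a := φ j x ^ 2) ?_ (hsq j hj hji).le
    rw [map_neg]
    linear_combination h2
  · exact absurd (key j₀ hj₀ hji₀) (by simp [h0])
  · refine main _ _ hzm.1 fun j hj hji => ?_
    have h1 := pos_of_mul_pos_right (key j hj hji) h0.le
    have h2 := mul_pos h1 (hxs j hj hji)
    refine pos_of_mul_pos_right (a := φ j x ^ 2) ?_ (hsq j hj hji).le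
    linear_combination h2

/-- Two forms with the wrong relative sign at `p` would keep it on an open neighbourhood, which
would then miss the face. -/
lemma IsZeroSets.exists_of_mem_closure (h : IsZeroSets s e φ)
    {y : Fin 3 → ℝ} (hy : y ≠ 0) (hys : ∀ i ∈ s, φ i y ≠ 0) {i : ι} (hi : i ∈ s)
    {p : RP2} (hpi : p ∈ e i) (hpj : ∀ j ∈ s, j ≠ i → p ∉ e j)
    (hp : p ∈ closure (faceAt (e '' s) (mk ℝ y hy))) :
    ∃ x hx, mk ℝ x hx = p ∧ φ i x = 0 ∧ ∀ j ∈ s, j ≠ i → 0 < φ j y * φ j x := by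
  induction p using Projectivization.ind with | h x hx =>
  have hne : ∀ j ∈ s, j ≠ i → φ j x ≠ 0 := fun j hj hji =>
    (h j hj x hx).not.1 (hpj j hj hji)
  have hix := (h i hi x hx).1 hpi
  have key : ∀ j ∈ s, j ≠ i → ∀ k ∈ s, k ≠ i → 0 < (φ j y * φ j x) * (φ k y * φ k x) := by
    intro j hj hji k hk hki
    by_contra hc
    have hxp : mk ℝ x hx ∈ posSet (φ j) ((-(φ j y * φ k y)) • φ k) := by
      rw [mk_mem_posSet]
      have h1 : φ j y * φ j x * (φ k y * φ k x) ≠ 0 :=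
        mul_ne_zero (mul_ne_zero (hys j hj) (hne j hj hji))
          (mul_ne_zero (hys k hk) (hne k hk hki))
      have h2 := lt_of_le_of_ne (not_lt.1 hc) h1
      simp only [LinearMap.smul_apply, smul_eq_mul]
      linear_combination h2
    obtain ⟨q, hq1, hq2⟩ := mem_closure_iff.1 hp _ (isOpen_posSet _ _) hxp
    induction q using Projectivization.ind with | h w hw =>
    rw [mk_mem_posSet] at hq1
    simp only [LinearMap.smul_apply, smul_eq_mul] at hq1
    rcases (h.mk_mem_faceAt_iff ⟨i, hi⟩ hw hy hys).1 hq2 with h1 | h1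
    · have := mul_pos (h1 j hj) (h1 k hk); linarith
    · have := mul_pos_of_neg_of_neg (h1 j hj) (h1 k hk); linarith
  by_cases hex : ∃ j ∈ s, j ≠ i ∧ φ j y * φ j x < 0
  · obtain ⟨j, hj, hji, hneg⟩ := hex
    refine ⟨-x, neg_ne_zero.2 hx, mk_neg hx, by simp [hix], fun k hk hki => ?_⟩
    have := key j hj hji k hk hki
    rw [map_neg]
    by_contra hc
    exact absurd this (not_lt.2 (mul_nonpos_of_nonpos_of_nonneg hneg.le (by linarith)))
  · push Not at hex
    refine ⟨x, hx, rfl, hix, fun j hj hji => lt_of_le_of_ne (hex j hj hji) ?_⟩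
    exact (mul_ne_zero (hys j hj) (hne j hj hji)).symm

/-- By convexity, a line contributes at most one edge to a face. -/
lemma IsZeroSets.connectedComponentIn_eq (h : IsZeroSets s e φ) (he : Set.InjOn e s)
    (hs : 2 ≤ s.card) {y : Fin 3 → ℝ} {i : ι} (hi : i ∈ s)
    {x x' : Fin 3 → ℝ} (hx0 : x ≠ 0) (hx0' : x' ≠ 0) (hx : φ i x = 0) (hx' : φ i x' = 0)
    (hxs : ∀ j ∈ s, j ≠ i → 0 < φ j y * φ j x) (hxs' : ∀ j ∈ s, j ≠ i → 0 < φ j y * φ j x') :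
    connectedComponentIn (e i \ vertices (e '' s)) (mk ℝ x hx0) =
      connectedComponentIn (e i \ vertices (e '' s)) (mk ℝ x' hx0') := by
  obtain ⟨j₀, hj₀, hji₀⟩ := Finset.exists_mem_ne (s := s) (by omega) i
  have hseg : ∀ w ∈ segment ℝ x x', φ i w = 0 ∧ ∀ j ∈ s, j ≠ i → φ j w ≠ 0 := by
    intro w hw
    refine ⟨?_, fun j hj hji h0 => ?_⟩
    · obtain ⟨a, b, _, _, _, rfl⟩ := hw
      simp [hx, hx']
    · have := ne_zero_of_mem_segment (hxs j hj hji) (hxs' j hj hji) hw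
      simp [h0] at this
  have hseg0 : ∀ w ∈ segment ℝ x x', w ≠ 0 := fun w hw h0 =>
    (hseg w hw).2 j₀ hj₀ hji₀ (by simp [h0])
  refine _root_.connectedComponentIn_eq ((isPreconnected_mk_image
    (convex_segment x x').isPreconnected hseg0).subset_connectedComponentIn ?_ ?_ ?_)
  · exact ⟨x, hx0, left_mem_segment ℝ x x', rfl⟩
  · rintro _ ⟨w, hw0, hw, rfl⟩
    exact (h.mk_mem_sdiff he hi hw0).2 (hseg w hw)
  · exact ⟨x', hx0', right_mem_segment ℝ x x', rfl⟩

open Classical in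
-- Sides correspond bijectively to boundary edges: edges on different lines differ because vertices
-- are removed. With at least two lines, every line carries a vertex and therefore has edges.
theorem IsZeroSets.faceSize_faceAt (h : IsZeroSets s e φ) (he : Set.InjOn e s)
    (hs : 2 ≤ s.card) {y : Fin 3 → ℝ} (hy : y ≠ 0) (hys : ∀ i ∈ s, φ i y ≠ 0) :
    faceSize (e '' s) (faceAt (e '' s) (mk ℝ y hy)) = (s.filter (IsSideAt s φ y)).card := by
  have hex : ∀ i ∈ s.filter (IsSideAt s φ y), ∃ x, x ≠ 0 ∧ φ i x = 0 ∧
      ∀ j ∈ s, j ≠ i → 0 < φ j y * φ j x := by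
    intro i hi
    obtain ⟨hi, x, hx, hxs⟩ := Finset.mem_filter.1 hi
    obtain ⟨j₀, hj₀, hji₀⟩ := Finset.exists_mem_ne (s := s) (by omega) i
    refine ⟨x, fun h0 => ?_, hx, hxs⟩
    have := hxs j₀ hj₀ hji₀
    simp [h0] at this
  have hex' : ∀ i ∈ s.filter (IsSideAt s φ y), ∃ p : RP2, ∃ x hx0, p = mk ℝ x hx0 ∧ φ i x = 0 ∧
      ∀ j ∈ s, j ≠ i → 0 < φ j y * φ j x := fun i hi => by
    obtain ⟨x, hx0, hx⟩ := hex i hi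
    exact ⟨_, x, hx0, rfl, hx⟩
  choose! p hp using hex'
  have hpm : ∀ i ∈ s.filter (IsSideAt s φ y), p i ∈ e i \ vertices (e '' s) := by
    intro i hi
    obtain ⟨x, hx0, hpx, hx, hxs⟩ := hp i hi
    rw [hpx]
    refine (h.mk_mem_sdiff he (Finset.mem_filter.1 hi).1 hx0).2 ⟨hx, fun j hj hji h0 => ?_⟩
    have := hxs j hj hji
    simp [h0] at this
  set g : ι → Set RP2 := fun i => connectedComponentIn (e i \ vertices (e '' s)) (p i) with hg
  have himg : {E ∈ edges (e '' s) | E ⊆ closure (faceAt (e '' s) (mk ℝ y hy))} =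
      g '' (s.filter (IsSideAt s φ y)) := by
    ext E
    constructor
    · rintro ⟨⟨_, ⟨i, hi, rfl⟩, -, q, hq, rfl⟩, hE⟩
      rw [Finset.mem_coe] at hi
      obtain ⟨x, hx0, rfl, hx, hxs⟩ := h.exists_of_mem_closure hy hys hi hq.1
        (fun j hj hji hqj => hq.2 ((mem_vertices_image he hi hq.1).2 ⟨j, hj, hji, hqj⟩))
        (hE (mem_connectedComponentIn hq))
      have hiF : i ∈ s.filter (IsSideAt s φ y) := Finset.mem_filter.2 ⟨hi, x, hx, hxs⟩
      refine ⟨i, hiF, ?_⟩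
      obtain ⟨x', hx0', hpx', hx', hxs'⟩ := hp i hiF
      simp only [hg, hpx']
      exact h.connectedComponentIn_eq he hs hi _ _ hx' hx hxs' hxs
    · rintro ⟨i, hiF, rfl⟩
      have hi := (Finset.mem_filter.1 hiF).1
      refine ⟨⟨e i, ⟨i, hi, rfl⟩, ?_, p i, hpm i hiF, rfl⟩, ?_⟩
      · obtain ⟨j, hj, hji⟩ := Finset.exists_mem_ne (s := s) (by omega) i
        obtain ⟨x, hx, hxi, hxj⟩ := exists_common_zero (φ i) (φ j)
        have hmem := (h i hi x hx).2 hxi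
        exact ⟨_, hmem, (mem_vertices_image he hi hmem).2 ⟨j, hj, hji, (h j hj x hx).2 hxj⟩⟩
      · obtain ⟨x, hx0, hpx, hx, hxs⟩ := hp i hiF
        simp only [hg, hpx]
        exact h.subset_closure_faceAt he hs hy hys hi hx0 hx hxs
  have hinj : Set.InjOn g (s.filter (IsSideAt s φ y)) := by
    intro i hi j hj hij
    have h1 := mem_connectedComponentIn (hpm i hi)
    have h2 : p i ∈ g j := hij ▸ h1
    have h3 := connectedComponentIn_subset _ _ h2
    by_contra hne
    exact h3.2 ((mem_vertices_image he (Finset.mem_filter.1 hj).1 h3.1).2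
      ⟨i, (Finset.mem_filter.1 hi).1, hne, (hpm i hi).1⟩)
  unfold faceSize
  rw [himg, hinj.ncard_image, Set.ncard_coe_finset]

end Arrangement

lemma faceSize_eq_zero {L : Set (Set RP2)} (hL : L.Subsingleton) (f : Set RP2) :
    faceSize L f = 0 := by
  have : {E ∈ edges L | E ⊆ closure f} = ∅ := by
    rw [Set.eq_empty_iff_forall_notMem]
    rintro E ⟨⟨l, -, ⟨v, -, l₁, h₁, l₂, h₂, hne, -⟩, -⟩, -⟩
    exact hne (hL h₁ h₂)
  rw [faceSize, this, Set.ncard_empty]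

/-! ### Coordinates adapted to a line. -/

/-- The linear form `y - t j * x + r j * z` in the coordinates given by `T`. -/
noncomputable def form (T : (Fin 3 → ℝ) ≃ₗ[ℝ] (Fin 3 → ℝ)) (t r : ℕ → ℝ) (j : ℕ) :
    (Fin 3 → ℝ) →ₗ[ℝ] ℝ :=
  (LinearMap.proj 1 - t j • LinearMap.proj 0 + r j • LinearMap.proj 2) ∘ₗ T.symm.toLinearMap

lemma form_apply (T : (Fin 3 → ℝ) ≃ₗ[ℝ] (Fin 3 → ℝ)) (t r : ℕ → ℝ) (j : ℕ) (v : Fin 3 → ℝ) :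
    form T t r j (T v) = v 1 - t j * v 0 + r j * v 2 := by
  simp [form]

/-- In the coordinates given by `T`, the line `l` is `z = 0`, and the `m` other lines of `L`, sorted
by their crossings with `l`, are the lines `y = t j * x - r j * z`. -/
structure IsCoordinates (L : Set (Set RP2)) (l : Set RP2) (m : ℕ)
    (T : (Fin 3 → ℝ) ≃ₗ[ℝ] (Fin 3 → ℝ)) (e : ℕ → Set RP2) (t r : ℕ → ℝ) : Prop where
  intro ::
  mem_line : ∀ v hv, mk ℝ (T v) hv ∈ l ↔ v 2 = 0
  image_eq : e '' (Finset.range m) = L \ {l}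
  injOn : Set.InjOn e (Finset.range m)
  isZeroSets : IsZeroSets (Finset.range m) e (form T t r)
  generic : GenericPoints t r m

lemma exists_sorted_enumeration {α : Type*} [Nonempty α] (S : Finset α) (f : α → ℝ)
    (hf : Set.InjOn f S) :
    ∃ e : ℕ → α, e '' (Finset.range S.card) = S ∧ ∀ i j, i < j → j < S.card → f (e i) < f (e j) := by
  classical
  induction S using Finset.induction_on_max_value f with
  | empty => exact ⟨fun _ => Classical.arbitrary α, by simp, by simp⟩
  | insert a S ha hmax ih =>
    obtain ⟨e, he, hlt⟩ := ih (hf.mono (by simp))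
    have hmem : ∀ i < S.card, e i ∈ S := fun i hi => by
      rw [← Finset.mem_coe, ← he]; exact ⟨i, by simpa using hi, rfl⟩
    rw [Finset.card_insert_of_notMem ha]
    refine ⟨Function.update e S.card a, ?_, fun i j hij hj => ?_⟩
    · rw [Finset.range_add_one, Finset.coe_insert, Finset.coe_insert, Set.image_insert_eq,
        Function.update_self, ← he]
      congr 1
      refine Set.image_congr fun i hi => ?_
      rw [Finset.mem_coe, Finset.mem_range] at hi
      exact Function.update_of_ne hi.ne _ _
    · rcases Nat.lt_succ_iff_lt_or_eq.1 hj with hj | rfl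
      · rw [Function.update_of_ne (hij.trans hj).ne, Function.update_of_ne hj.ne]
        exact hlt i j hij hj
      · rw [Function.update_of_ne hij.ne, Function.update_self]
        refine lt_of_le_of_ne (hmax _ (hmem i hij)) fun h => ha ?_
        rw [← hf (Finset.mem_coe.2 (Finset.mem_insert_of_mem (hmem i hij)))
          (Finset.mem_coe.2 (Finset.mem_insert_self a S)) h]
        exact hmem i hij

lemma IsLine.exists_form {l : Set RP2} (hl : IsLine l) :
    ∃ φ : (Fin 3 → ℝ) →ₗ[ℝ] ℝ, φ ≠ 0 ∧ ∀ x hx, mk ℝ x hx ∈ l ↔ φ x = 0 := by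
  obtain ⟨a, rfl⟩ := hl
  induction a using Projectivization.ind with | h a ha =>
  refine ⟨dotProductBilin ℝ ℝ a, fun h => ha ?_, fun x hx => ?_⟩
  · have := LinearMap.congr_fun h a
    simpa [dotProductBilin] using this
  · have := orthogonal_mk (F := ℝ) hx ha
    rw [dotProduct_comm] at this
    exact this

lemma exists_basis_ker {φ : (Fin 3 → ℝ) →ₗ[ℝ] ℝ} (hφ : φ ≠ 0) :
    ∃ u w : Fin 3 → ℝ, φ u = 0 ∧ φ w = 0 ∧ ∀ a b : ℝ, a • u + b • w = 0 → a = 0 ∧ b = 0 := by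
  have h1 := φ.finrank_range_add_finrank_ker
  rw [LinearMap.range_eq_top.2 (LinearMap.surjective hφ), finrank_top, Module.finrank_self,
    Module.finrank_fin_fun] at h1
  have b := Module.finBasisOfFinrankEq ℝ (LinearMap.ker φ) (n := 2) (by omega)
  refine ⟨b 0, b 1, (b 0).2, (b 1).2, fun x y hxy => ?_⟩
  have := Fintype.linearIndependent_iff.1 b.linearIndependent ![x, y]
    (by rw [Fin.sum_univ_two]; exact Subtype.ext hxy)
  exact ⟨this 0, this 1⟩

/-- The basis is `w`, `Q = u + q • w` on `l`, and `R` off `l`. As `Q` lies on no other line, each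
other form can be scaled to have `y`-coefficient 1. General position of triples containing `l` makes
the `t j` distinct; for the other triples it is, by duality, noncollinearity of the points `(t j, r
j)`. -/
lemma exists_coordinates {L : Set (Set RP2)} (hfin : L.Finite) (hline : ∀ l ∈ L, IsLine l)
    (hgen : InGeneralPosition L) {l : Set RP2} (hl : l ∈ L) :
    ∃ T e t r, IsCoordinates L l (L.ncard - 1) T e t r := by
  classical
  have hforms : ∀ k ∈ L, ∃ φ : (Fin 3 → ℝ) →ₗ[ℝ] ℝ, φ ≠ 0 ∧ ∀ x hx, mk ℝ x hx ∈ k ↔ φ x = 0 :=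
    fun k hk => (hline k hk).exists_form
  choose! φ hφ0 hφ using hforms
  obtain ⟨u, w, hu, hw, huw⟩ := exists_basis_ker (hφ0 l hl)
  obtain ⟨R, hR⟩ : ∃ R, φ l R ≠ 0 := by
    by_contra! h
    exact hφ0 l hl (LinearMap.ext h)
  have hindep : ∀ q : ℝ, LinearIndependent ℝ ![w, u + q • w, R] := by
    intro q
    rw [Fintype.linearIndependent_iff]
    intro g hg
    simp only [Fin.sum_univ_three, Matrix.cons_val_zero, Matrix.cons_val_one, Matrix.cons_val] at hg
    have h2 := congrArg (φ l) hg
    simp only [map_add, map_smul, hu, hw, smul_eq_mul, mul_zero, add_zero, zero_add, map_zero,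
      mul_eq_zero, hR, or_false] at h2
    rw [h2, zero_smul, add_zero] at hg
    have h3 := huw (g 1) (g 0 + g 1 * q) (by rw [← hg]; module)
    have h4 : g 0 = 0 := by have := h3.2; rwa [h3.1, zero_mul, add_zero] at this
    intro i
    fin_cases i
    · exact h4
    · exact h3.1
    · exact h2
  let B : ℝ → Module.Basis (Fin 3) ℝ (Fin 3 → ℝ) := fun q =>
    basisOfLinearIndependentOfCardEqFinrank (hindep q) (by simp)
  have hT : ∀ q v, (B q).equivFun.symm v = v 0 • w + v 1 • (u + q • w) + v 2 • R := by
    intro q v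
    rw [Module.Basis.equivFun_symm_apply, Fin.sum_univ_three]
    simp [B]
  have hTl : ∀ q v hv, mk ℝ ((B q).equivFun.symm v) hv ∈ l ↔ v 2 = 0 := by
    intro q v hv
    rw [hφ l hl, hT]
    simp [hu, hw, hR]
  have hS : (L \ {l}).Finite := hfin.sdiff
  have hne : ∀ k ∈ L \ {l}, ¬ (φ k u = 0 ∧ φ k w = 0) := by
    rintro k ⟨hk, hkl⟩ ⟨h1, h2⟩
    refine hkl ?_
    have hval : ∀ v, φ k ((B 0).equivFun.symm v) = v 2 * φ k R := fun v => by
      rw [hT]; simp [h1, h2]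
    have hkR : φ k R ≠ 0 := by
      intro h0
      refine hφ0 k hk (LinearMap.ext fun x => ?_)
      obtain ⟨v, rfl⟩ := (B 0).equivFun.symm.surjective x
      rw [hval, h0, mul_zero]; rfl
    rw [Set.mem_singleton_iff]
    ext p
    induction p using Projectivization.ind with | h x hx =>
    obtain ⟨v, rfl⟩ := (B 0).equivFun.symm.surjective x
    rw [hTl, hφ k hk, hval]
    simp [hkR]
  -- Each line other than `l` excludes at most one value of `q`.
  obtain ⟨q, hq⟩ : ∃ q : ℝ, ∀ k ∈ L \ {l}, φ k (u + q • w) ≠ 0 := by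
    have hfinset : (⋃ k ∈ L \ {l}, {q : ℝ | φ k (u + q • w) = 0}).Finite := by
      refine hS.biUnion fun k hk => Set.Subsingleton.finite fun a ha b hb => ?_
      simp only [Set.mem_ofPred_eq, map_add, map_smul, smul_eq_mul] at ha hb
      have hw0 : φ k w ≠ 0 := fun h0 => hne k hk ⟨by simpa [h0] using ha, h0⟩
      exact mul_right_cancel₀ hw0 (by linarith)
    obtain ⟨q, hq⟩ := hfinset.infinite_compl.nonempty
    simp only [Set.mem_compl_iff, Set.mem_iUnion, not_exists] at hq
    exact ⟨q, hq⟩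
  set Q := u + q • w with hQ
  let τ : Set RP2 → ℝ := fun k => -(φ k w / φ k Q)
  let ρ : Set RP2 → ℝ := fun k => φ k R / φ k Q
  have hmem : ∀ k ∈ L \ {l}, ∀ v hv, mk ℝ ((B q).equivFun.symm v) hv ∈ k ↔
      v 1 - τ k * v 0 + ρ k * v 2 = 0 := by
    intro k hk v hv
    have hQ0 := hq k hk
    have e1 : φ k (v 0 • w + v 1 • Q + v 2 • R) =
        φ k Q * (v 1 - τ k * v 0 + ρ k * v 2) := by
      simp only [map_add, map_smul, smul_eq_mul, τ, ρ]
      field_simp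
      ring
    rw [hφ k hk.1, hT, e1, mul_eq_zero, or_iff_right hQ0]
  have hvec : ∀ v : Fin 3 → ℝ, v ≠ 0 → (B q).equivFun.symm v ≠ 0 := fun v hv =>
    (LinearEquiv.map_ne_zero_iff _).2 hv
  have hτ : Set.InjOn τ (hS.toFinset) := by
    intro k hk k' hk' hkk'
    rw [Set.Finite.coe_toFinset] at hk hk'
    by_contra hne'
    have hv : (![1, τ k, 0] : Fin 3 → ℝ) ≠ 0 := fun h => by simpa using congrFun h 0
    have hgen' := hgen l hl k hk.1 k' hk'.1 (Ne.symm hk.2) (Ne.symm hk'.2) hne'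
    rw [Set.eq_empty_iff_forall_notMem] at hgen'
    refine hgen' (mk ℝ _ (hvec _ hv)) ⟨⟨?_, ?_⟩, ?_⟩
    · rw [hTl]; simp
    · rw [hmem k hk]; simp
    · rw [hmem k' hk', ← hkk']; simp
  obtain ⟨e, he, hlt⟩ := exists_sorted_enumeration hS.toFinset τ hτ
  have hcard : hS.toFinset.card = L.ncard - 1 := by
    rw [← Set.ncard_eq_toFinset_card _ hS, Set.ncard_sdiff_singleton_of_mem hl]
  rw [hcard] at he hlt
  rw [Set.Finite.coe_toFinset] at he
  have heL : ∀ i < L.ncard - 1, e i ∈ L \ {l} := fun i hi => by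
    rw [← he]; exact ⟨i, by simpa using hi, rfl⟩
  have hinj : Set.InjOn e (Finset.range (L.ncard - 1)) := by
    intro i hi j hj hij
    rw [Finset.mem_coe, Finset.mem_range] at hi hj
    by_contra hne'
    rcases lt_or_gt_of_ne hne' with h | h
    · exact (hlt i j h hj).ne (by rw [hij])
    · exact (hlt j i h hi).ne (by rw [hij])
  refine ⟨(B q).equivFun.symm, e, fun j => τ (e j), fun j => ρ (e j), hTl q, he, hinj, ?_, hlt, ?_⟩
  · intro i hi x hx
    obtain ⟨v, rfl⟩ := (B q).equivFun.symm.surjective x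
    rw [hmem _ (heL i (Finset.mem_range.1 hi)), form_apply]
  · intro i j k hi hj hk hij hik hjk heq
    have htij : τ (e i) - τ (e j) ≠ 0 := fun h0 => hij
      (hinj (by simpa using hi) (by simpa using hj) (hτ (by simpa using heL i hi)
        (by simpa using heL j hj) (sub_eq_zero.1 h0)))
    set X := ρ (e i) - ρ (e j) with hX
    set Z := τ (e i) - τ (e j) with hZ
    -- The crossing point of `e i` and `e j`; collinearity would put it on `e k` too.
    have hv : (![X, τ (e i) * X - ρ (e i) * Z, Z] : Fin 3 → ℝ) ≠ 0 := fun h =>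
      htij (by simpa using congrFun h 2)
    have hinjne : ∀ a b, a < L.ncard - 1 → b < L.ncard - 1 → a ≠ b → e a ≠ e b :=
      fun a b ha hb hab h => hab (hinj (by simpa using ha) (by simpa using hb) h)
    have hgen' := hgen _ (heL i hi).1 _ (heL j hj).1 _ (heL k hk).1 (hinjne i j hi hj hij)
      (hinjne i k hi hk hik) (hinjne j k hj hk hjk)
    rw [Set.eq_empty_iff_forall_notMem] at hgen'
    refine hgen' (mk ℝ _ (hvec _ hv)) ⟨⟨?_, ?_⟩, ?_⟩
    · rw [hmem _ (heL i hi)]; simp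
    · rw [hmem _ (heL j hj)]
      simp only [Matrix.cons_val_zero, Matrix.cons_val_one, Matrix.cons_val, hX, hZ]; ring
    · rw [hmem _ (heL k hk)]
      simp only [Matrix.cons_val_zero, Matrix.cons_val_one, Matrix.cons_val, hX, hZ]
      linear_combination -heq

/-! ### From the arrangement to cells and back. -/

section

variable {L : Set (Set RP2)} {l : Set RP2} {m : ℕ} {T : (Fin 3 → ℝ) ≃ₗ[ℝ] (Fin 3 → ℝ)}
  {e : ℕ → Set RP2} {t r : ℕ → ℝ}

/-- The point of the line `l` with homogeneous coordinates `(1, q, 0)`. -/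
noncomputable def linePoint (T : (Fin 3 → ℝ) ≃ₗ[ℝ] (Fin 3 → ℝ)) (q : ℝ) : Fin 3 → ℝ := T ![1, q, 0]

lemma linePoint_ne_zero (T : (Fin 3 → ℝ) ≃ₗ[ℝ] (Fin 3 → ℝ)) (q : ℝ) : linePoint T q ≠ 0 := by
  intro h
  simpa using congrFun (T.map_eq_zero_iff.1 h) 0

lemma form_linePoint (q : ℝ) (j : ℕ) : form T t r j (linePoint T q) = q - t j := by
  rw [linePoint, form_apply]; simp

lemma isSideAt_linePoint_iff (s : Finset ℕ) (q : ℝ) (i : ℕ) :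
    IsSideAt s (form T t r) (linePoint T q) i ↔ IsSide t r s (fun j => q - t j) i := by
  constructor
  · rintro ⟨x, hx, h⟩
    obtain ⟨v, rfl⟩ := T.surjective x
    refine ⟨v 0, v 2, fun j hj hji => ?_⟩
    have := h j hj hji
    rw [form_linePoint, form_apply] at this
    rw [form_apply] at hx
    have e1 : v 1 - t j * v 0 + r j * v 2 = (t i - t j) * v 0 + (r j - r i) * v 2 := by
      linear_combination hx
    rwa [e1] at this
  · rintro ⟨x, z, h⟩
    refine ⟨T ![x, t i * x - r i * z, z], by rw [form_apply]; simp, fun j hj hji => ?_⟩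
    have := h j hj hji
    rw [form_linePoint, form_apply]
    convert this using 2
    simp only [Matrix.cons_val_zero, Matrix.cons_val_one, Matrix.cons_val]
    ring

lemma IsCoordinates.faceSize_linePoint (h : IsCoordinates L l m T e t r) {s : Finset ℕ}
    (hs : s ⊆ Finset.range m) (hs2 : 2 ≤ s.card) {q : ℝ} {σ : ℕ → ℝ}
    (hσ : ∀ j ∈ s, 0 < σ j * (q - t j)) :
    faceSize (e '' s) (faceAt (e '' s) (mk ℝ _ (linePoint_ne_zero T q))) = sideCount t r s σ := by
  classical
  rw [(h.isZeroSets.mono hs).faceSize_faceAt (h.injOn.mono (Finset.coe_subset.2 hs)) hs2,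
    sideCount_congr (τ := fun j => q - t j) hσ]
  · unfold sideCount
    congr 1
    exact Finset.filter_congr fun i _ => isSideAt_linePoint_iff s q i
  · intro j hj h0
    have := hσ j hj
    rw [form_linePoint] at h0
    simp [h0] at this

lemma GenericPoints.exists_cell (h : GenericPoints t r m) (k : ℕ) :
    ∃ q : ℝ, ∀ j < m, 0 < cellSign k j * (q - t j) := by
  have hle : ∀ i j, i ≤ j → j < m → t i ≤ t j := fun i j hij hj => by
    rcases hij.eq_or_lt with rfl | hij
    · exact le_rfl
    · exact (h.lt i j hij hj).le
  suffices ∃ q : ℝ, ∀ j < m, (j < k → t j < q) ∧ (k ≤ j → q < t j) by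
    obtain ⟨q, hq⟩ := this
    refine ⟨q, fun j hj => ?_⟩
    unfold cellSign
    split_ifs with hjk
    · have := (hq j hj).1 hjk; linarith
    · have := (hq j hj).2 (not_lt.1 hjk); linarith
  rcases Nat.eq_zero_or_pos k with rfl | hk
  · refine ⟨t 0 - 1, fun j hj => ⟨fun h => absurd h (Nat.not_lt_zero j), fun _ => ?_⟩⟩
    have := hle 0 j (Nat.zero_le j) hj
    linarith
  · rcases lt_or_ge k m with hkm | hkm
    · obtain ⟨q, h1, h2⟩ := exists_between (h.lt (k - 1) k (by omega) hkm)
      exact ⟨q, fun j hj => ⟨fun hjk => (hle j (k - 1) (by omega) (by omega)).trans_lt h1,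
        fun hkj => h2.trans_le (hle k j hkj hj)⟩⟩
    · refine ⟨t (m - 1) + 1, fun j hj => ⟨fun _ => ?_, fun h => by omega⟩⟩
      have := hle j (m - 1) (by omega) (by omega)
      linarith

lemma IsCoordinates.linePoint_mem (h : IsCoordinates L l m T e t r) (q : ℝ) :
    mk ℝ _ (linePoint_ne_zero T q) ∈ l :=
  (h.mem_line _ (linePoint_ne_zero T q)).2 (by simp)

/-- Since cells 0 and `m` are the same face, cells `1, …, m` list each face met by `l` once. -/
lemma IsCoordinates.lineComplexity_eq (h : IsCoordinates L l m T e t r) (hm : 2 ≤ m) :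
    lineComplexity L l =
      ∑ k ∈ Finset.range m, sideCount t r (Finset.range m) (cellSign (k + 1)) := by
  choose q hq using fun k => h.generic.exists_cell (k + 1)
  have hne : (Finset.range m).Nonempty := ⟨0, by simp; omega⟩
  have hq0 : ∀ k, ∀ j ∈ Finset.range m, form T t r j (linePoint T (q k)) ≠ 0 := by
    intro k j hj h0
    have := hq k j (Finset.mem_range.1 hj)
    rw [form_linePoint] at h0
    simp [h0] at this
  have hcompl : ∀ k, mk ℝ _ (linePoint_ne_zero T (q k)) ∈ (⋃₀ (e '' (Finset.range m)))ᶜ :=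
    fun k => (h.isZeroSets.mk_mem_compl _).2 (hq0 k)
  unfold lineComplexity
  rw [← h.image_eq, ← finsum_mem_coe_finset]
  symm
  refine finsum_mem_eq_of_bijOn (fun k => faceAt (e '' (Finset.range m))
    (mk ℝ _ (linePoint_ne_zero T (q k)))) ⟨?_, ?_, ?_⟩ ?_
  · exact fun k hk => ⟨⟨_, hcompl k, rfl⟩, _, mem_connectedComponentIn (hcompl k), h.linePoint_mem _⟩
  · have key : ∀ k k', k < k' → k' < m →
        faceAt (e '' (Finset.range m)) (mk ℝ _ (linePoint_ne_zero T (q k))) ≠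
        faceAt (e '' (Finset.range m)) (mk ℝ _ (linePoint_ne_zero T (q k'))) := by
      intro k k' hkk' hk' heq
      rw [faceAt_eq_iff (hcompl k), h.isZeroSets.mk_mem_faceAt_iff hne _ _ (hq0 k')] at heq
      simp only [form_linePoint, Finset.mem_range] at heq
      have a1 := hq k 0 (by omega)
      have a2 := hq k' 0 (by omega)
      have a3 := hq k k' hk'
      have a4 := hq k' k' hk'
      simp only [cellSign, Nat.zero_lt_succ, if_true, one_mul] at a1 a2
      rw [cellSign, if_neg (by omega)] at a3
      rw [cellSign, if_pos (by omega)] at a4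
      rcases heq with heq | heq
      · have := heq k' hk'
        have := mul_pos a3 a4
        linarith
      · have := heq 0 (by omega)
        have := mul_pos a1 a2
        linarith
    intro k hk k' hk' heq
    rw [Finset.mem_coe, Finset.mem_range] at hk hk'
    by_contra hne'
    rcases lt_or_gt_of_ne hne' with h1 | h1
    · exact key k k' h1 hk' heq
    · exact key k' k h1 hk heq.symm
  · rintro f ⟨⟨p, hp, rfl⟩, w, hwf, hwl⟩
    have hwf' : faceAt (e '' (Finset.range m)) p = faceAt (e '' (Finset.range m)) w :=
      connectedComponentIn_eq hwf
    have hwc : w ∈ (⋃₀ (e '' (Finset.range m)))ᶜ := connectedComponentIn_subset _ _ hwf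
    rw [hwf']
    clear hwf hwf' hp p
    induction w using Projectivization.ind with | h w hw =>
    obtain ⟨v, rfl⟩ := T.surjective w
    have hv2 := (h.mem_line v hw).1 hwl
    have hv := (h.isZeroSets.mk_mem_compl hw).1 hwc
    simp only [form_apply, hv2, mul_zero, add_zero, Finset.mem_range] at hv
    suffices ∃ k < m, (∀ j < m, 0 < (q k - t j) * (v 1 - t j * v 0)) ∨
        (∀ j < m, (q k - t j) * (v 1 - t j * v 0) < 0) by
      obtain ⟨k, hk, hkv⟩ := this
      refine ⟨k, by simpa using hk, ?_⟩
      refine ((faceAt_eq_iff hwc).2 ?_).symm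
      rw [h.isZeroSets.mk_mem_faceAt_iff hne _ _ (hq0 k)]
      simpa only [form_linePoint, form_apply, hv2, mul_zero, add_zero, Finset.mem_range] using hkv
    have hlast : ∀ j < m, 0 < q (m - 1) - t j := fun j hj => by
      have := hq (m - 1) j hj
      rwa [cellSign, if_pos (by omega), one_mul] at this
    -- The point `(0 : 1 : 0)` at infinity on `l` belongs to the last cell.
    by_cases hv0 : v 0 = 0
    · refine ⟨m - 1, by omega, ?_⟩
      simp only [hv0, mul_zero, sub_zero] at hv ⊢
      rcases lt_or_gt_of_ne (hv 0 (by omega)) with h1 | h1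
      · exact Or.inr fun j hj => mul_neg_of_pos_of_neg (hlast j hj) h1
      · exact Or.inl fun j hj => mul_pos (hlast j hj) h1
    · set a := v 1 / v 0 with ha
      have hva : ∀ j, v 1 - t j * v 0 = v 0 * (a - t j) := fun j => by
        rw [ha]; field_simp
      have hat : ∀ j < m, a ≠ t j := fun j hj h0 => hv j hj (by rw [hva, h0]; simp)
      suffices ∃ k < m, (∀ j < m, 0 < (q k - t j) * (a - t j)) ∨
          (∀ j < m, (q k - t j) * (a - t j) < 0) by
        obtain ⟨k, hk, hkv⟩ := this
        refine ⟨k, hk, ?_⟩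
        have e1 : ∀ j, (q k - t j) * (v 1 - t j * v 0) = v 0 * ((q k - t j) * (a - t j)) :=
          fun j => by rw [hva]; ring
        simp only [e1]
        rcases lt_or_gt_of_ne hv0 with h0 | h0 <;> rcases hkv with h1 | h1
        · exact Or.inr fun j hj => mul_neg_of_neg_of_pos h0 (h1 j hj)
        · exact Or.inl fun j hj => mul_pos_of_neg_of_neg h0 (h1 j hj)
        · exact Or.inl fun j hj => mul_pos h0 (h1 j hj)
        · exact Or.inr fun j hj => mul_neg_of_pos_of_neg h0 (h1 j hj)
      -- The least such index is the number of crossings before `a`; the value `m` serves when no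
      -- crossing lies beyond `a`.
      have hex : ∃ j, m ≤ j ∨ a < t j := ⟨m, Or.inl le_rfl⟩
      classical
      set k := Nat.find hex with hk
      have hbelow : ∀ j < m, j < k → t j < a := fun j hj hjk => by
        have := Nat.find_min hex hjk
        push Not at this
        exact lt_of_le_of_ne this.2 (hat j hj).symm
      have habove : ∀ j < m, k ≤ j → a < t j := fun j hj hkj => by
        have hspec := Nat.find_spec hex
        rcases hkj.eq_or_lt with h1 | h1
        · rw [← h1]
          exact hspec.resolve_left (by omega)
        · exact (hspec.resolve_left (by omega)).trans (h.generic.lt k j h1 hj)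
      have hkm : k ≤ m := Nat.find_le (Or.inl le_rfl)
      rcases Nat.eq_zero_or_pos k with h0 | h0
      -- Before the first crossing: this is cell `m`, with all signs reversed.
      · refine ⟨m - 1, by omega, Or.inr fun j hj => ?_⟩
        have := habove j hj (by omega)
        exact mul_neg_of_pos_of_neg (hlast j hj) (by linarith)
      · refine ⟨k - 1, by omega, Or.inl fun j hj => ?_⟩
        have h1 := hq (k - 1) j hj
        rw [Nat.sub_add_cancel h0] at h1
        unfold cellSign at h1
        split_ifs at h1 with hjk
        · exact mul_pos (by linarith) (by have := hbelow j hj hjk; linarith)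
        · exact mul_pos_of_neg_of_neg (by linarith)
            (by have := habove j hj (not_lt.1 hjk); linarith)
  · intro k _
    exact (h.faceSize_linePoint subset_rfl (by simpa using hm)
      fun j hj => hq k j (Finset.mem_range.1 hj)).symm

lemma IsCoordinates.linePoint_mem_iff (h : IsCoordinates L l m T e t r) {i j : ℕ} (hi : i < m)
    (hj : j < m) : mk ℝ _ (linePoint_ne_zero T (t i)) ∈ e j ↔ i = j := by
  rw [h.isZeroSets j (Finset.mem_range.2 hj), form_linePoint, sub_eq_zero]
  refine ⟨fun hij => ?_, fun hij => by rw [hij]⟩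
  by_contra hne
  rcases lt_or_gt_of_ne hne with h1 | h1
  · exact (h.generic.lt i j h1 hj).ne hij
  · exact (h.generic.lt j i h1 hi).ne hij.symm

lemma IsCoordinates.bijOn_vertices (h : IsCoordinates L l m T e t r) (hl : l ∈ L) :
    Set.BijOn (fun i => mk ℝ _ (linePoint_ne_zero T (t i))) (Finset.range m) (vertices L ∩ l) := by
  have hmem : ∀ i < m, e i ∈ L \ {l} := fun i hi => by
    rw [← h.image_eq]; exact ⟨i, by simpa using hi, rfl⟩
  refine ⟨fun i hi => ⟨?_, h.linePoint_mem _⟩, fun i hi j hj hij => ?_, ?_⟩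
  · rw [Finset.mem_coe, Finset.mem_range] at hi
    exact ⟨l, hl, e i, (hmem i hi).1, Ne.symm (hmem i hi).2, h.linePoint_mem _,
      (h.linePoint_mem_iff hi hi).2 rfl⟩
  · rw [Finset.mem_coe, Finset.mem_range] at hi hj
    have h1 := (h.linePoint_mem_iff hj hj).2 rfl
    simp only at hij
    rw [← hij, h.linePoint_mem_iff hi hj] at h1
    exact h1
  · rintro p ⟨⟨l₁, h₁, l₂, h₂, hne, hp₁, hp₂⟩, hpl⟩
    obtain ⟨k, hk, hpk⟩ : ∃ k ∈ L \ {l}, p ∈ k := by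
      by_cases h0 : l₁ = l
      · exact ⟨l₂, ⟨h₂, fun h2 => hne (h0.trans h2.symm)⟩, hp₂⟩
      · exact ⟨l₁, ⟨h₁, h0⟩, hp₁⟩
    rw [← h.image_eq] at hk
    obtain ⟨i, hi, rfl⟩ := hk
    refine ⟨i, hi, ?_⟩
    induction p using Projectivization.ind with | h x hx =>
    obtain ⟨v, rfl⟩ := T.surjective x
    have hv2 := (h.mem_line v hx).1 hpl
    rw [h.isZeroSets i hi, form_apply, hv2, mul_zero, add_zero] at hpk
    have hv : v = v 0 • ![1, t i, 0] := by
      ext j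
      fin_cases j
      · simp
      · simp; linarith
      · simpa using hv2
    have hv0 : v 0 ≠ 0 := fun h0 => hx (by rw [hv, h0, zero_smul, map_zero])
    refine (mk_eq_mk_iff' ℝ _ _ _ _).2 ⟨(v 0)⁻¹, ?_⟩
    rw [linePoint, ← map_smul]
    congr 1
    conv_lhs => rw [hv]
    simp [hv0]

lemma IsCoordinates.not_mem_lines_eq (h : IsCoordinates L l m T e t r) {i : ℕ} (hi : i < m) :
    {k ∈ L | mk ℝ _ (linePoint_ne_zero T (t i)) ∉ k} = e '' ((Finset.range m).erase i) := by
  ext k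
  constructor
  · rintro ⟨hk, hik⟩
    have hkl : k ∈ L \ {l} := ⟨hk, fun h0 => hik (by rw [h0]; exact h.linePoint_mem _)⟩
    rw [← h.image_eq] at hkl
    obtain ⟨j, hj, rfl⟩ := hkl
    refine ⟨j, ?_, rfl⟩
    rw [Finset.mem_coe] at hj ⊢
    refine Finset.mem_erase.2 ⟨fun hji => hik ?_, hj⟩
    exact (h.linePoint_mem_iff hi (Finset.mem_range.1 hj)).2 hji.symm
  · rintro ⟨j, hj, rfl⟩
    rw [Finset.mem_coe, Finset.mem_erase] at hj
    have : e j ∈ L \ {l} := by rw [← h.image_eq]; exact ⟨j, hj.2, rfl⟩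
    exact ⟨this.1, fun hij => hj.1 ((h.linePoint_mem_iff hi (Finset.mem_range.1 hj.2)).1 hij).symm⟩

lemma IsCoordinates.vertexComplexity_eq (h : IsCoordinates L l m T e t r) (hm : 3 ≤ m) {i : ℕ}
    (hi : i < m) : vertexComplexity L (mk ℝ _ (linePoint_ne_zero T (t i))) =
      sideCount t r ((Finset.range m).erase i) (cellSign (i + 1)) := by
  rw [vertexComplexity, h.not_mem_lines_eq hi]
  refine h.faceSize_linePoint (Finset.erase_subset _ _) ?_ fun j hj => ?_
  · rw [Finset.card_erase_of_mem (Finset.mem_range.2 hi), Finset.card_range]; omega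
  · rw [Finset.mem_erase, Finset.mem_range] at hj
    exact h.generic.cellSign_mul_pos hi hj.2 hj.1

lemma IsCoordinates.vertexComplexity_eq_zero (h : IsCoordinates L l m T e t r) (hm : m ≤ 2) {i : ℕ}
    (hi : i < m) : vertexComplexity L (mk ℝ _ (linePoint_ne_zero T (t i))) = 0 := by
  rw [vertexComplexity, h.not_mem_lines_eq hi]
  refine faceSize_eq_zero (Set.Subsingleton.image ?_ e) _
  intro a ha b hb
  rw [Finset.mem_coe, Finset.mem_erase, Finset.mem_range] at ha hb
  omega

/-- The case `m = 2` needs its own count: a single remaining line gives `sideCount` 1 but has no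
edge, so `vertexComplexity` is 0. The identity still holds, as `2 + 2 = 0 + 4`. -/
lemma GenericPoints.sideCount_two (h : GenericPoints t r 2) (k : ℕ) :
    sideCount t r (Finset.range 2) (cellSign k) = 2 := by
  classical
  unfold sideCount
  rw [Finset.filter_true_of_mem]
  · simp
  · intro i hi
    rw [Finset.mem_range] at hi
    have h01 := h.lt 0 1 (by omega) (by omega)
    have hσ : cellSign k (1 - i) ≠ 0 := by unfold cellSign; split_ifs <;> norm_num
    have ht : t i - t (1 - i) ≠ 0 := by
      rcases (by omega : i = 0 ∨ i = 1) with rfl | rfl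
      · simpa [sub_eq_zero] using h01.ne
      · simpa [sub_eq_zero] using h01.ne'
    refine ⟨cellSign k (1 - i) * (t i - t (1 - i)), 0, fun j hj hji => ?_⟩
    rw [Finset.mem_range] at hj
    obtain rfl : j = 1 - i := by omega
    have := mul_self_pos.2 (mul_ne_zero hσ ht)
    linear_combination this

lemma IsCoordinates.two_mul_lineComplexity (h : IsCoordinates L l m T e t r) (hm : 2 ≤ m) :
    2 * lineComplexity L l = ∑ i ∈ Finset.range m,
      vertexComplexity L (mk ℝ _ (linePoint_ne_zero T (t i))) + 4 * m := by
  have hsum : ∑ i ∈ Finset.range m, (sideCount t r (Finset.range m) (cellSign (i + 1)) +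
      sideCount t r (Finset.range m) (cellSign i)) = ∑ i ∈ Finset.range m,
      (vertexComplexity L (mk ℝ _ (linePoint_ne_zero T (t i))) + 4) := by
    refine Finset.sum_congr rfl fun i hi => ?_
    rw [Finset.mem_range] at hi
    rcases hm.eq_or_lt with rfl | hm
    · rw [h.vertexComplexity_eq_zero le_rfl hi, h.generic.sideCount_two, h.generic.sideCount_two]
    · rw [h.vertexComplexity_eq hm hi, h.generic.sideCount_add hi]
      omega
  -- Cells 0 and `m` have equal counts, so the sums over cells `0, …, m - 1` and `1, …, m` agree.
  have hshift := (Finset.sum_range_succ' (fun k => sideCount t r (Finset.range m) (cellSign k))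
    m).symm.trans (Finset.sum_range_succ _ m)
  rw [sideCount_cellSign_zero] at hshift
  rw [Finset.sum_add_distrib, Finset.sum_add_distrib, Finset.sum_const, Finset.card_range,
    smul_eq_mul, ← Nat.add_right_cancel hshift, ← h.lineComplexity_eq hm] at hsum
  omega

lemma IsCoordinates.exists_vertexComplexity_le (h : IsCoordinates L l m T e t r) (hm : 1 ≤ m) :
    ∃ i < m, vertexComplexity L (mk ℝ _ (linePoint_ne_zero T (t i))) ≤ 7 := by
  rcases le_or_gt m 2 with hm2 | hm2
  · exact ⟨0, hm, by rw [h.vertexComplexity_eq_zero hm2 hm]; omega⟩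
  by_contra! hc
  have h1 := h.two_mul_lineComplexity (by omega)
  have h2 := h.generic.sum_sideCount_le hm
  rw [Finset.sum_range_succ', ← h.lineComplexity_eq (by omega)] at h2
  -- This gives `2 C(ℓ) ≥ 8m + 4m`, against `C(ℓ) ≤ 6m - 4`.
  have h3 : ∑ _i ∈ Finset.range m, 8 ≤ ∑ i ∈ Finset.range m,
      vertexComplexity L (mk ℝ _ (linePoint_ne_zero T (t i))) :=
    Finset.sum_le_sum fun i hi => hc i (Finset.mem_range.1 hi)
  rw [Finset.sum_const, Finset.card_range, smul_eq_mul] at h3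
  omega

end

end LineArrangement

theorem mainTheorem2 (L : Set (Set LineArrangement.RP2)) (n : ℕ)
    (hfin : L.Finite) (hcard : L.ncard = n) (hn : 2 ≤ n)
    (hline : ∀ l ∈ L, LineArrangement.IsLine l)
    (hgen : LineArrangement.InGeneralPosition L) :
    (∀ l ∈ L, ∃ v ∈ LineArrangement.vertices L,
      v ∈ l ∧ LineArrangement.vertexComplexity L v ≤ 7) ∧
    LineArrangement.minVertexComplexity L ≤ 7 ∧
    (3 ≤ n → ∀ l ∈ L,
      (LineArrangement.lineComplexity L l : ℝ) =
        (1 / 2 : ℝ) * (∑ᶠ v ∈ LineArrangement.vertices L ∩ l,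
          (LineArrangement.vertexComplexity L v : ℝ)) + 2 * ((n : ℝ) - 1)) := by
  have hvertex : ∀ l ∈ L, ∃ v ∈ LineArrangement.vertices L,
      v ∈ l ∧ LineArrangement.vertexComplexity L v ≤ 7 := by
    intro l hl
    obtain ⟨T, e, t, r, h⟩ := LineArrangement.exists_coordinates hfin hline hgen hl
    obtain ⟨i, hi, hle⟩ := h.exists_vertexComplexity_le (by omega)
    have hmem := (h.bijOn_vertices hl).mapsTo (by simpa using hi : i ∈ (Finset.range _ : Set ℕ))
    exact ⟨_, hmem.1, hmem.2, hle⟩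
  refine ⟨hvertex, ?_, fun hn3 l hl => ?_⟩
  · obtain ⟨l, hl⟩ : L.Nonempty := Set.nonempty_of_ncard_ne_zero (by omega)
    obtain ⟨v, hv, -, hle⟩ := hvertex l hl
    exact le_trans (Nat.sInf_le (Set.mem_image_of_mem _ hv)) hle
  · obtain ⟨T, e, t, r, h⟩ := LineArrangement.exists_coordinates hfin hline hgen hl
    have h2 := h.two_mul_lineComplexity (by omega)
    rw [← finsum_mem_eq_of_bijOn _ (h.bijOn_vertices hl) fun i _ => rfl, finsum_mem_coe_finset]
    rw [hcard] at h2 ⊢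
    have h3 : ((2 * LineArrangement.lineComplexity L l : ℕ) : ℝ) = _ := congrArg Nat.cast h2
    push_cast [Nat.cast_sub (show 1 ≤ n by omega)] at h3
    linarith
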